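/- **Setting.** Let $D\subset\mathbb R^{p}$ be a finite set of MPC cost parameters with a metric $d$, let $k\le 1$ be a positive (semi)definite kernel on $D$ with reproducing kernel Hilbert space $H_k$, and let $q\in H_k$ be the unknown performance function, with $\|q\|_k\le B$ and $|q(\theta)-q(\theta')|\le L\,d(\theta,\theta')$ on $D$. Fix $\tau\in\mathbb R$, $\varepsilon>0$, $\delta\in(0,1)$ and a known seed $S_0\subseteq D$ with $q\ge\tau$ on $S_0$. Evaluating $\theta_n$ ($n\ge1$) returns $y_n=q(\theta_n)+\eta_n$, where $\eta_n$ is conditionally $\sigma_\eta$-sub-Gaussian given the past ($\sigma_\eta>0$) and $\theta_n$ is determined by the past. Let $\mu_n,\sigma_n$ be the Gaussian process posterior mean and standard deviation after $n$ measurements (prior mean $0$, covariance $k$, noise variance $\sigma_\eta^2$). Let $\gamma_n=\sup_A I(y_A;q_A)$ over all tuples $A$ of at most $n$ points of $D$ (repetitions allowed), where $I$ is the mutual information between the Gaussian process at $A$ and its measurements with Gaussian noise of variance $\sigma_\eta^2$, that is $I(y_A;q_A)=\tfrac12\log\det(\mathrm{Id}+\sigma_\eta^{-2}K_A)$. Let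 $$\sqrt{\beta_n}=B+\max(4\sigma_\eta,\sqrt2)\,\sqrt{\gamma_n+1+\ln(1/\delta)} .$$ The confidence bounds are $u_0=\sqrt{\beta_1}\,\sigma_0$ and $l_0=-\sqrt{\beta_1}\,\sigma_0$, where on $S_0$ the known bound is used, $l_0=\max(\tau,-\sqrt{\beta_1}\sigma_0)$, and for $n\ge1$ $$l_n=\max\bigl(l_{n-1},\ \mu_n-\sqrt{\beta_{n+1}}\,\sigma_n\bigr),\qquad u_n=\min\bigl(u_{n-1},\ \mu_n+\sqrt{\beta_{n+1}}\,\sigma_n\bigr),\qquad w_n=u_n-l_n .$$ For $v:D\to\mathbb R$ and $S\subseteq D$ let $F_v(S)=\{\theta\in D:\exists\theta'\in S,\ v(\theta')-L\,d(\theta,\theta')\ge\tau\}$ and $\tilde F_v(S)=\lim_{m\to\infty}F_v^m(S)$. The $\varepsilon$-reachable safe set is $R_\varepsilon=\tilde F_{q-\varepsilon}(S_0)$. The pessimistic and optimistic sets are $P_0=S_0$, $O_0=D$, $P_n=\tilde F_{l_n}(P_{n-1})$ and $O_n=\tilde F_{u_n-\varepsilon}(P_{n-1})$. **Algorithm (COAt-MPC).**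 After $n=0,1,2,\dots$ measurements choose a goal $\theta^g\in\arg\max_{O_n}u_n$. If $\theta^g\in P_n$ and $w_n(\theta^g)<\varepsilon$, terminate and recommend $\theta^g$. If $\theta^g\in P_n$ and $w_n(\theta^g)\ge\varepsilon$, evaluate $\theta_{n+1}=\theta^g$. If $\theta^g\notin P_n$, let $\theta_{n+1}$ be a point closest to $\theta^g$ in Euclidean distance among the $\theta\in P_n$ with $w_n(\theta)\ge\varepsilon$, and evaluate it. Ties are broken arbitrarily. If there is no goal or no such point, the algorithm halts without a recommendation. **MPC.** Running the system with parameter $\theta$ means that $\hat x(t+1)=f(\hat x(t),u(t))$, $\hat x(0)$ lies in a given set of initial states, and $u(t)$ is the first input of an optimal solution of $\min\sum_{i=0}^N l(x_i,u_i,\theta)$ subject to $x_0=\hat x(t)$, $x_{i+1}=f(x_i,u_i)$, $x_i\in\mathcal X$, $u_i\in\mathcal U$. As a standing assumption, for a parameter with $q(\theta)\ge\tau$ this problem remains solvable along the closed loop. **Theorem 1.** Assume moreover that $\beta_n\gamma_n=o(n)$. Then there is a largest integer $n^\star\geq 0$ with $n^\star\varepsilon^2\le C_1\,\beta_{n^\star}\gamma_{n^\star}$,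 i.e. $\frac{n^\star}{\beta_{n^\star}\gamma_{n^\star}}\le\frac{C_1}{\varepsilon^2}$, where $C_1=8/\log(1+\sigma_\eta^{-2})$. With probability at least $1-\delta$ the following hold together. 1. Every evaluated parameter satisfies $q(\theta_n)\ge\tau$, and the closed-loop system under MPC with $\theta_n$ satisfies $\hat x(t)\in\mathcal X$ and $u(t)\in\mathcal U$ for all times $t\ge0$. 2. If $R_\varepsilon\ne\emptyset$ and $w_0(\theta)\ge\varepsilon$ for some $\theta\in S_0$, then the algorithm terminates after some number $n\le n^\star$ of evaluations, and the recommended parameter $\theta^g$ satisfies $$q(\theta^g)\ \ge\ \max_{\theta\in R_\varepsilon}q(\theta)-\varepsilon ,$$ as well as $q(\theta^g)\ge\tau$ and the closed-loop state and input constraints. Here $n^\star$ depends on $D$ only through $\gamma_n$: the size of $D$ does not enter explicitly. -/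

import Mathlib

open MeasureTheory ProbabilityTheory Filter Topology

noncomputable section

/-! ### Model predictive control -/

/-- The data of an MPC scheme with tunable cost parameter in `ℝ^p`: prediction horizon, stage cost
`l(x, u, θ)`, dynamics `f(x, u)`, state constraint set and input constraint set. -/
structure MPCScheme (p nx nu : ℕ) where
  horizon : ℕ
  stageCost : EuclideanSpace ℝ (Fin nx) → EuclideanSpace ℝ (Fin nu) →
    EuclideanSpace ℝ (Fin p) → ℝ
  dynamics : EuclideanSpace ℝ (Fin nx) → EuclideanSpace ℝ (Fin nu) → EuclideanSpace ℝ (Fin nx)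
  stateSet : Set (EuclideanSpace ℝ (Fin nx))
  inputSet : Set (EuclideanSpace ℝ (Fin nu))

namespace MPCScheme

variable {p nx nu : ℕ} (M : MPCScheme p nx nu)

/-- `(x₀, …, x_N)`, `(u₀, …, u_N)` is feasible for the MPC problem at the current state `xhat`. -/
def Feasible (xhat : EuclideanSpace ℝ (Fin nx))
    (x : Fin (M.horizon + 1) → EuclideanSpace ℝ (Fin nx))
    (u : Fin (M.horizon + 1) → EuclideanSpace ℝ (Fin nu)) : Prop :=
  x 0 = xhat ∧
  (∀ i : Fin M.horizon, x i.succ = M.dynamics (x i.castSucc) (u i.castSucc)) ∧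
  ∀ i, x i ∈ M.stateSet ∧ u i ∈ M.inputSet

/-- The MPC objective `∑_{i=0}^N l(x_i, u_i, θ)`. -/
def cost (θ : EuclideanSpace ℝ (Fin p))
    (x : Fin (M.horizon + 1) → EuclideanSpace ℝ (Fin nx))
    (u : Fin (M.horizon + 1) → EuclideanSpace ℝ (Fin nu)) : ℝ :=
  ∑ i, M.stageCost (x i) (u i) θ

/-- `(x, u)` is an optimal solution of the MPC problem with parameter `θ` at state `xhat`. -/
def IsOptimal (θ : EuclideanSpace ℝ (Fin p)) (xhat : EuclideanSpace ℝ (Fin nx))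
    (x : Fin (M.horizon + 1) → EuclideanSpace ℝ (Fin nx))
    (u : Fin (M.horizon + 1) → EuclideanSpace ℝ (Fin nu)) : Prop :=
  M.Feasible xhat x u ∧ ∀ x' u', M.Feasible xhat x' u' → M.cost θ x u ≤ M.cost θ x' u'

/-- The MPC problem with parameter `θ` at state `xhat` has an optimal solution. -/
def Solvable (θ : EuclideanSpace ℝ (Fin p)) (xhat : EuclideanSpace ℝ (Fin nx)) : Prop :=
  ∃ x u, M.IsOptimal θ xhat x u

/-- `(xhat, u)` is a closed-loop trajectory of the system under MPC with parameter `θ`: at each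
time the first input of an optimal solution is applied. At a state where the MPC problem has no
solution the applied input is arbitrary. -/
def IsClosedLoop (θ : EuclideanSpace ℝ (Fin p)) (xhat : ℕ → EuclideanSpace ℝ (Fin nx))
    (u : ℕ → EuclideanSpace ℝ (Fin nu)) : Prop :=
  ∀ t, xhat (t + 1) = M.dynamics (xhat t) (u t) ∧
    (M.Solvable θ (xhat t) → ∃ x' u', M.IsOptimal θ (xhat t) x' u' ∧ u t = u' 0)

/-- Along every closed loop with parameter `θ` that starts in `I`, the MPC problem keeps having a
solution. -/
def StaysFeasible (I : Set (EuclideanSpace ℝ (Fin nx))) (θ : EuclideanSpace ℝ (Fin p)) : Prop :=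
  ∀ xhat u, xhat 0 ∈ I → M.IsClosedLoop θ xhat u → ∀ t, M.Solvable θ (xhat t)

/-- Every closed loop with parameter `θ` that starts in `I` satisfies the state and input
constraints at all times. -/
def ConstraintsHold (I : Set (EuclideanSpace ℝ (Fin nx))) (θ : EuclideanSpace ℝ (Fin p)) : Prop :=
  ∀ xhat u, xhat 0 ∈ I → M.IsClosedLoop θ xhat u →
    ∀ t, xhat t ∈ M.stateSet ∧ u t ∈ M.inputSet

end MPCScheme

/-! ### Noise -/

/-- The noise `η n` is conditionally `σ`-sub-Gaussian given the past `ℱ n`. -/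
def IsCondSubGaussian {Ω : Type*} [mΩ : MeasurableSpace Ω] (P : Measure Ω) (ℱ : Filtration ℕ mΩ)
    (η : ℕ → Ω → ℝ) (σ : ℝ) : Prop :=
  ∀ (n : ℕ) (s : ℝ), Integrable (fun ω => Real.exp (s * η n ω)) P ∧
    P[fun ω => Real.exp (s * η n ω) | ℱ n] ≤ᵐ[P] fun _ => Real.exp (s ^ 2 * σ ^ 2 / 2)

/-! ### The tuning problem and the algorithm -/

/-- The input of the tuner: a finite parameter domain `D` with a metric `d`, a positive
(semi)definite kernel `k ≤ 1`, an initial seed `S₀`, the threshold `τ`, the Lipschitz constant `L`,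
the tolerance `ε`, the noise level `σ`, the RKHS norm bound `B` and the failure probability `δ`. -/
structure TuningProblem (p : ℕ) where
  D : Finset (EuclideanSpace ℝ (Fin p))
  d : MetricSpace D
  k : D → D → ℝ
  S₀ : Set D
  τ : ℝ
  L : ℝ
  ε : ℝ
  σ : ℝ
  B : ℝ
  δ : ℝ
  k_posSemidef : (Matrix.of k).PosSemidef
  k_le_one : ∀ a b, k a b ≤ 1
  L_nonneg : 0 ≤ L
  ε_pos : 0 < ε
  σ_pos : 0 < σ
  δ_pos : 0 < δ
  δ_lt_one : δ < 1

namespace TuningProblem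

variable {p : ℕ} (c : TuningProblem p)

/-- The metric `d` on the parameter domain (not necessarily the Euclidean one). -/
def dst (a b : c.D) : ℝ := c.d.dist a b

/-- The covariance matrix of the locations `A 0, …, A (m - 1)`, repetitions allowed. -/
def cov {m : ℕ} (A : Fin m → c.D) : Matrix (Fin m) (Fin m) ℝ :=
  Matrix.of fun i j => c.k (A i) (A j)

/-- Differential entropy of the Gaussian law with covariance `C`. -/
def gaussianEntropy {m : ℕ} (C : Matrix (Fin m) (Fin m) ℝ) : ℝ :=
  Real.log ((2 * Real.pi * Real.exp 1) • C).det / 2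

/-- Mutual information `I(y_A; q_A) = H(y_A) - H(y_A | q_A)`, for `q` a centred Gaussian process
with covariance `k` and independent Gaussian noise of variance `σ²`. -/
def mutualInfo {m : ℕ} (A : Fin m → c.D) : ℝ :=
  gaussianEntropy (c.cov A + c.σ ^ 2 • (1 : Matrix (Fin m) (Fin m) ℝ)) -
    gaussianEntropy (c.σ ^ 2 • (1 : Matrix (Fin m) (Fin m) ℝ))

/-- The maximum information capacity `γ_n`: at most `n` measurements, where a location may be
measured repeatedly. -/
def γ (n : ℕ) : ℝ := ⨆ A : (m : Fin (n + 1)) × (Fin m → c.D), c.mutualInfo A.2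

/-- The confidence scaling `√β_n`. -/
def sqrtβ (n : ℕ) : ℝ :=
  c.B + max (4 * c.σ) (√2) * √(c.γ n + 1 + Real.log (1 / c.δ))

/-- `β_n`. -/
def β (n : ℕ) : ℝ := c.sqrtβ n ^ 2

/-- The constant `C₁ = 8 / log (1 + σ⁻²)`. -/
def C₁ : ℝ := 8 / Real.log (1 + (c.σ ^ 2)⁻¹)

section Posterior

/-! In this section `θ 0, θ 1, …` are the evaluated parameters and `y 0, y 1, …` the measured
values; the quantities with index `n` use only the first `n` of them. -/

variable (θ : ℕ → c.D) (y : ℕ → ℝ)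

/-- The regularized covariance matrix `K_n + σ² I` of the first `n` locations. -/
def regCov (n : ℕ) : Matrix (Fin n) (Fin n) ℝ :=
  c.cov (fun i : Fin n => θ i) + c.σ ^ 2 • (1 : Matrix (Fin n) (Fin n) ℝ)

/-- The vector `k_n(x)`. -/
def kvec (n : ℕ) (x : c.D) : Fin n → ℝ := fun i => c.k (θ i) x

/-- Posterior mean after `n` measurements. -/
def mean (n : ℕ) (x : c.D) : ℝ :=
  c.kvec θ n x ⬝ᵥ ((c.regCov θ n)⁻¹).mulVec (fun i : Fin n => y i)

/-- Posterior covariance after `n` measurements. -/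
def postCov (n : ℕ) (x x' : c.D) : ℝ :=
  c.k x x' - c.kvec θ n x ⬝ᵥ ((c.regCov θ n)⁻¹).mulVec (c.kvec θ n x')

/-- Posterior standard deviation after `n` measurements. -/
def sd (n : ℕ) (x : c.D) : ℝ := √(c.postCov θ n x x)

end Posterior

/-- Prior lower confidence bound: prior mean `0`, prior standard deviation `√k(x,x)`; on the seed
the known bound `q ≥ τ` is taken into account. -/
def lower₀ (x : c.D) : ℝ :=
  open Classical in
  if x ∈ c.S₀ then max c.τ (-(c.sqrtβ 1 * √(c.k x x))) else -(c.sqrtβ 1 * √(c.k x x))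

/-- Prior upper confidence bound. -/
def upper₀ (x : c.D) : ℝ := c.sqrtβ 1 * √(c.k x x)

section Algorithm

variable (θ : ℕ → c.D) (y : ℕ → ℝ)

/-- The intersected lower confidence bound after `n` measurements. -/
def lower : ℕ → c.D → ℝ
  | 0, x => c.lower₀ x
  | n + 1, x => max (lower n x) (c.mean θ y (n + 1) x - c.sqrtβ (n + 2) * c.sd θ (n + 1) x)

/-- The intersected upper confidence bound after `n` measurements. -/
def upper : ℕ → c.D → ℝ
  | 0, x => c.upper₀ x
  | n + 1, x => min (upper n x) (c.mean θ y (n + 1) x + c.sqrtβ (n + 2) * c.sd θ (n + 1) x)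

/-- Width of the confidence interval after `n` measurements. -/
def width (n : ℕ) (x : c.D) : ℝ := c.upper θ y n x - c.lower θ y n x

/-- One-step operator `S ↦ {x ∈ D | ∃ x' ∈ S, v(x') - L d(x, x') ≥ τ}`. -/
def step (v : c.D → ℝ) (S : Set c.D) : Set c.D :=
  {x | ∃ x' ∈ S, v x' - c.L * c.dst x x' ≥ c.τ}

/-- The limit, as `m → ∞`, of the `m`-fold application of the one-step operator. -/
def expand (v : c.D → ℝ) (S : Set c.D) : Set c.D :=
  {x | ∀ᶠ m in atTop, x ∈ (c.step v)^[m] S}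

/-- The `ε`-reachable safe set of the performance function `q`. -/
def reachable (q : c.D → ℝ) : Set c.D := c.expand (fun x => q x - c.ε) c.S₀

/-- The pessimistic set after `n` measurements. -/
def pess : ℕ → Set c.D
  | 0 => c.S₀
  | n + 1 => c.expand (c.lower θ y (n + 1)) (pess n)

/-- The optimistic set after `n` measurements. -/
def opti : ℕ → Set c.D
  | 0 => Set.univ
  | n + 1 => c.expand (fun x => c.upper θ y (n + 1) x - c.ε) (c.pess θ y n)

/-- `a` is a goal: a maximizer of the upper confidence bound over the optimistic set. -/
def IsGoal (n : ℕ) (a : c.D) : Prop :=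
  a ∈ c.opti θ y n ∧ ∀ x ∈ c.opti θ y n, c.upper θ y n x ≤ c.upper θ y n a

/-- Constrained expansion: `x` is a point of the pessimistic set, not yet `ε`-accurate, that is
closest to the goal `a` in Euclidean distance. -/
def IsExpansion (n : ℕ) (a x : c.D) : Prop :=
  (x ∈ c.pess θ y n ∧ c.ε ≤ c.width θ y n x) ∧
  ∀ x' ∈ c.pess θ y n, c.ε ≤ c.width θ y n x' →
    ‖(a : EuclideanSpace ℝ (Fin p)) - x‖ ≤ ‖(a : EuclideanSpace ℝ (Fin p)) - x'‖

/-- After `n` measurements the algorithm terminates and recommends the goal `a`. -/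
def Terminates (n : ℕ) (a : c.D) : Prop :=
  c.IsGoal θ y n a ∧ a ∈ c.pess θ y n ∧ c.width θ y n a < c.ε

/-- After `n` measurements the algorithm has the goal `a` and evaluates `x` next. -/
def Evaluates (n : ℕ) (a x : c.D) : Prop :=
  c.IsGoal θ y n a ∧
  ((a ∉ c.pess θ y n ∧ c.IsExpansion θ y n a x) ∨
    (a ∈ c.pess θ y n ∧ c.ε ≤ c.width θ y n a ∧ x = a))

/-- After `n` measurements the algorithm can neither terminate nor evaluate: there is no goal, or
the goal `a` is outside the pessimistic set and constrained expansion has no candidate. -/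
def IsStuck (n : ℕ) (a : c.D) : Prop :=
  c.opti θ y n = ∅ ∨
  (c.IsGoal θ y n a ∧ a ∉ c.pess θ y n ∧ ∀ x ∈ c.pess θ y n, c.width θ y n x < c.ε)

/-- A run of the algorithm that makes exactly `T` evaluations (possibly infinitely many), with
goals `a 0, a 1, …`, evaluated parameters `θ 0, θ 1, …` and measurements `y 0, y 1, …`. Only the
entries `θ i`, `y i` with `i < T` and `a i` with `i ≤ T` matter. Ties are broken arbitrarily. -/
def IsRun (a : ℕ → c.D) (T : ℕ∞) : Prop :=
  (∀ n : ℕ, (n : ℕ∞) < T → c.Evaluates θ y n (a n) (θ n)) ∧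
  (∀ n : ℕ, (n : ℕ∞) = T → c.Terminates θ y n (a n) ∨ c.IsStuck θ y n (a n))

end Algorithm

end TuningProblem

end

/-! Randomness enters through a single event of probability at least `1 - δ`, on which `q` lies
between the confidence bounds after every number of measurements. The rest of the argument is
deterministic.

As `D` is finite, `q x = φ x ⬝ᵥ w` with `‖w‖ ≤ B`, for finite-dimensional features `φ` representing
`k` (`RKHS.exists_finite_features`). The Gaussian process posterior is then Bayesian linear
regression with features `ψ i = σ⁻¹ • φ (θ i)` and unit noise (`mean_eq`, `postCov_eq`). With
precision `V` and noise sum `S` after `n` rounds, Cauchy–Schwarz bounds the error of the posterior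
mean by the posterior deviation times `‖w‖ + √(S ⬝ᵥ V⁻¹ *ᵥ S)`. The process `exp (S ⬝ᵥ V⁻¹ *ᵥ S / 2)
/ √(det V)` is a supermartingale started at `1`, so by Ville's inequality it stays below `1 / δ` for
all `n` at once, without a union bound (`measure_mixture_ge_le`). Since `log (det V)` is twice the
mutual information, hence at most `2 γ_n`, this gives the scaling `sqrtβ` (`abs_mean_sub_le`).

On this event the pessimistic sets are safe by the Lipschitz bound, and the optimistic sets contain
the reachable set. So the goal's upper bound dominates `q` on that set, and a goal of width below
`ε` is `ε`-optimal. If no pessimistic point is wider than `ε`, the optimistic set is contained in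
the pessimistic one, so the algorithm cannot get stuck (`not_isStuck`). Each evaluation has width at
least `ε` and so gains a definite amount of information; comparing the total with `γ_n` bounds the
number of evaluations (`card_mul_sq_le`). -/

noncomputable section

/-! ### Bayesian linear regression with standard normal prior and unit noise -/

namespace LinearRegression

open Matrix

set_option linter.unusedSectionVars false

variable {ι : Type*} [Fintype ι] [DecidableEq ι]

/-- Posterior precision matrix after observing along the features `ψ 0, …, ψ (n - 1)`. -/
def precision (ψ : ℕ → ι → ℝ) (n : ℕ) : Matrix ι ι ℝ :=
  1 + ∑ i ∈ Finset.range n, vecMulVec (ψ i) (ψ i)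

/-- The noise sum `∑ ζ i • ψ i`. -/
def score (ψ : ℕ → ι → ℝ) (ζ : ℕ → ℝ) (n : ℕ) : ι → ℝ :=
  ∑ i ∈ Finset.range n, ζ i • ψ i

lemma precision_zero (ψ : ℕ → ι → ℝ) : precision ψ 0 = 1 := by simp [precision]

lemma precision_succ (ψ : ℕ → ι → ℝ) (n : ℕ) :
    precision ψ (n + 1) = precision ψ n + vecMulVec (ψ n) (ψ n) := by
  simp [precision, Finset.sum_range_succ, add_assoc]

lemma score_succ (ψ : ℕ → ι → ℝ) (ζ : ℕ → ℝ) (n : ℕ) :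
    score ψ ζ (n + 1) = score ψ ζ n + ζ n • ψ n := by
  simp [score, Finset.sum_range_succ]

lemma posDef_precision (ψ : ℕ → ι → ℝ) (n : ℕ) : (precision ψ n).PosDef :=
  PosDef.one.add_posSemidef
    (posSemidef_sum _ fun i _ => by simpa using posSemidef_vecMulVec_self_star (ψ i))

lemma dotProduct_mulVec_comm_of_isHermitian {A : Matrix ι ι ℝ} (hA : A.IsHermitian) (v w : ι → ℝ) :
    v ⬝ᵥ A *ᵥ w = w ⬝ᵥ A *ᵥ v := by
  have h : Aᵀ = A := by simpa [IsHermitian, conjTranspose_eq_transpose_of_trivial] using hA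
  rw [dotProduct_mulVec, ← mulVec_transpose, h, dotProduct_comm]

lemma dotProduct_mulVec_self_nonneg {A : Matrix ι ι ℝ} (hA : A.PosSemidef) (v : ι → ℝ) :
    0 ≤ v ⬝ᵥ A *ᵥ v := by
  simpa using hA.dotProduct_mulVec_nonneg v

lemma dotProduct_mulVec_sq_le {A : Matrix ι ι ℝ} (hA : A.PosSemidef) (v w : ι → ℝ) :
    (v ⬝ᵥ A *ᵥ w) ^ 2 ≤ (v ⬝ᵥ A *ᵥ v) * (w ⬝ᵥ A *ᵥ w) := by
  have h : ∀ t : ℝ, 0 ≤ (w ⬝ᵥ A *ᵥ w) * (t * t) + (2 * (v ⬝ᵥ A *ᵥ w)) * t + v ⬝ᵥ A *ᵥ v := by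
    intro t
    have := dotProduct_mulVec_self_nonneg hA (v + t • w)
    simp only [mulVec_add, mulVec_smul, add_dotProduct, dotProduct_add, smul_dotProduct,
      dotProduct_smul, smul_eq_mul, dotProduct_mulVec_comm_of_isHermitian hA.1 w v] at this
    linarith
  have := discrim_le_zero h
  simp only [discrim] at this
  linarith

lemma abs_dotProduct_mulVec_le {A : Matrix ι ι ℝ} (hA : A.PosSemidef) (v w : ι → ℝ) :
    |v ⬝ᵥ A *ᵥ w| ≤ √(v ⬝ᵥ A *ᵥ v) * √(w ⬝ᵥ A *ᵥ w) := by
  rw [← Real.sqrt_mul (dotProduct_mulVec_self_nonneg hA v)]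
  exact Real.abs_le_sqrt (dotProduct_mulVec_sq_le hA v w)

lemma inv_mulVec_eq_of_mulVec_eq {A : Matrix ι ι ℝ} (hA : A.PosDef) {v w : ι → ℝ}
    (h : A *ᵥ v = w) : A⁻¹ *ᵥ w = v := by
  rw [← h, mulVec_mulVec, nonsing_inv_mul _ ((isUnit_iff_isUnit_det _).1 hA.isUnit), one_mulVec]

lemma mulVec_inv_mulVec {A : Matrix ι ι ℝ} (hA : A.PosDef) (v : ι → ℝ) :
    A *ᵥ (A⁻¹ *ᵥ v) = v := by
  rw [mulVec_mulVec, mul_nonsing_inv _ ((isUnit_iff_isUnit_det _).1 hA.isUnit), one_mulVec]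

/-- Quadratic form of the inverse after a rank one update (Sherman–Morrison). -/
lemma quadForm_inv_rankOne_update {A : Matrix ι ι ℝ} (hA : A.PosDef) (b v : ι → ℝ) (z : ℝ) :
    (b + z • v) ⬝ᵥ (A + vecMulVec v v)⁻¹ *ᵥ (b + z • v) = b ⬝ᵥ A⁻¹ *ᵥ b +
      (2 * z * (v ⬝ᵥ A⁻¹ *ᵥ b) + z ^ 2 * (v ⬝ᵥ A⁻¹ *ᵥ v) - (v ⬝ᵥ A⁻¹ *ᵥ b) ^ 2) /
        (1 + v ⬝ᵥ A⁻¹ *ᵥ v) := by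
  have hs := dotProduct_mulVec_self_nonneg hA.inv.posSemidef v
  have hsym := dotProduct_mulVec_comm_of_isHermitian hA.inv.1 b v
  have hA' : (A + vecMulVec v v).PosDef :=
    hA.add_posSemidef (by simpa using posSemidef_vecMulVec_self_star v)
  set m := v ⬝ᵥ A⁻¹ *ᵥ b with hm
  set s := v ⬝ᵥ A⁻¹ *ᵥ v with hs'
  -- The updated solution is the old one plus a multiple of the gain `A⁻¹ *ᵥ v`, the multiple being
  -- the innovation `z - m` over `1 + s`.
  have h1 : (A + vecMulVec v v)⁻¹ *ᵥ (b + z • v) =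
      A⁻¹ *ᵥ b + ((z - m) / (1 + s)) • A⁻¹ *ᵥ v := by
    apply inv_mulVec_eq_of_mulVec_eq hA'
    simp only [add_mulVec, mulVec_add, mulVec_smul, mulVec_inv_mulVec hA, vecMulVec_mulVec,
      ← hm, ← hs', op_smul_eq_smul]
    ext i
    simp only [Pi.add_apply, Pi.smul_apply, smul_eq_mul]
    field_simp
    ring
  rw [h1]
  simp only [add_dotProduct, dotProduct_add, smul_dotProduct, dotProduct_smul, smul_eq_mul, hsym,
    ← hm, ← hs']
  field_simp
  ring

lemma det_rankOne_update {A : Matrix ι ι ℝ} (hA : A.PosDef) (v : ι → ℝ) :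
    (A + vecMulVec v v).det = A.det * (1 + v ⬝ᵥ A⁻¹ *ᵥ v) := by
  rw [vecMulVec_eq Unit, det_add_replicateCol_mul_replicateRow
    ((isUnit_iff_isUnit_det _).1 hA.isUnit)]
  congr 1
  rw [Matrix.mul_assoc, ← replicateCol_mulVec, det_unique]
  simp

/-- Variance of the next observation. -/
def predVar (ψ : ℕ → ι → ℝ) (n : ℕ) : ℝ := ψ n ⬝ᵥ (precision ψ n)⁻¹ *ᵥ ψ n

lemma predVar_nonneg (ψ : ℕ → ι → ℝ) (n : ℕ) : 0 ≤ predVar ψ n :=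
  dotProduct_mulVec_self_nonneg (posDef_precision ψ n).inv.posSemidef _

lemma det_precision_succ (ψ : ℕ → ι → ℝ) (n : ℕ) :
    (precision ψ (n + 1)).det = (precision ψ n).det * (1 + predVar ψ n) := by
  rw [precision_succ, det_rankOne_update (posDef_precision ψ n), predVar]

lemma log_det_precision (ψ : ℕ → ι → ℝ) (n : ℕ) :
    Real.log (precision ψ n).det = ∑ i ∈ Finset.range n, Real.log (1 + predVar ψ i) := by
  induction n with
  | zero => simp [precision_zero]
  | succ n ih =>
    rw [det_precision_succ, Real.log_mul (posDef_precision ψ n).det_pos.ne'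
      (by linarith [predVar_nonneg ψ n]), ih, Finset.sum_range_succ]

/-- Mean of the next noise term under the posterior of the mixture. -/
def predMean (ψ : ℕ → ι → ℝ) (ζ : ℕ → ℝ) (n : ℕ) : ℝ :=
  ψ n ⬝ᵥ (precision ψ n)⁻¹ *ᵥ score ψ ζ n

/-- The exponential process of the method of mixtures. -/
def mixture (ψ : ℕ → ι → ℝ) (ζ : ℕ → ℝ) (n : ℕ) : ℝ :=
  Real.exp (score ψ ζ n ⬝ᵥ (precision ψ n)⁻¹ *ᵥ score ψ ζ n / 2) / √(precision ψ n).det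

lemma mixture_zero (ψ : ℕ → ι → ℝ) (ζ : ℕ → ℝ) : mixture ψ ζ 0 = 1 := by
  simp [mixture, score, precision_zero]

lemma mixture_pos (ψ : ℕ → ι → ℝ) (ζ : ℕ → ℝ) (n : ℕ) : 0 < mixture ψ ζ n :=
  div_pos (Real.exp_pos _) (Real.sqrt_pos.2 (posDef_precision ψ n).det_pos)

/-- Normalizing constant of the one-dimensional Gaussian mixture with mean `m` and variance `s`,
at the noise value `z`. -/
def mixtureFactor (m s z : ℝ) : ℝ :=
  Real.exp ((2 * z * m + z ^ 2 * s - m ^ 2) / (2 * (1 + s))) / √(1 + s)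

/-- Sherman–Morrison handles the exponent and the rank-one determinant formula the normalization.
The factor's parameters are determined before the noise `ζ n` is seen, which reduces the
supermartingale property to one dimension. -/
lemma mixture_succ (ψ : ℕ → ι → ℝ) (ζ : ℕ → ℝ) (n : ℕ) :
    mixture ψ ζ (n + 1) =
      mixture ψ ζ n * mixtureFactor (predMean ψ ζ n) (predVar ψ n) (ζ n) := by
  rw [mixture, mixture, mixtureFactor, det_precision_succ, score_succ, precision_succ,
    quadForm_inv_rankOne_update (posDef_precision ψ n),
    Real.sqrt_mul (posDef_precision ψ n).det_pos.le, div_mul_div_comm, ← Real.exp_add]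
  congr 2
  have := predVar_nonneg ψ n
  simp only [predMean, predVar] at *
  field_simp

lemma quadForm_score_le_of_mixture_lt {x : ℝ} (ψ : ℕ → ι → ℝ) (ζ : ℕ → ℝ) (n : ℕ) (hx : 0 < x)
    (h : mixture ψ ζ n < x) :
    score ψ ζ n ⬝ᵥ (precision ψ n)⁻¹ *ᵥ score ψ ζ n ≤
      Real.log (precision ψ n).det + 2 * Real.log x := by
  have hd := (posDef_precision ψ n).det_pos
  rw [mixture, div_lt_iff₀ (Real.sqrt_pos.2 hd)] at h
  have h2 := Real.log_lt_log (Real.exp_pos _) h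
  rw [Real.log_exp, Real.log_mul hx.ne' (Real.sqrt_pos.2 hd).ne', Real.log_sqrt hd.le] at h2
  linarith

lemma precision_mulVec (ψ : ℕ → ι → ℝ) (n : ℕ) (w : ι → ℝ) :
    precision ψ n *ᵥ w = w + ∑ i ∈ Finset.range n, (ψ i ⬝ᵥ w) • ψ i := by
  simp [precision, add_mulVec, sum_mulVec, vecMulVec_mulVec]

/-- The precision dominates the identity: with `u = V⁻¹ w` and `w = u + r`, the difference of the
two sides is `r ⬝ᵥ u + r ⬝ᵥ r`, and both terms are nonnegative. -/
lemma quadForm_inv_precision_le (ψ : ℕ → ι → ℝ) (n : ℕ) (w : ι → ℝ) :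
    w ⬝ᵥ (precision ψ n)⁻¹ *ᵥ w ≤ w ⬝ᵥ w := by
  set u := (precision ψ n)⁻¹ *ᵥ w with hu
  have hw : w = u + ∑ i ∈ Finset.range n, (ψ i ⬝ᵥ u) • ψ i := by
    rw [← precision_mulVec, hu, mulVec_inv_mulVec (posDef_precision ψ n)]
  set r := ∑ i ∈ Finset.range n, (ψ i ⬝ᵥ u) • ψ i with hr
  have h1 : 0 ≤ r ⬝ᵥ u := by
    rw [hr, sum_dotProduct]
    exact Finset.sum_nonneg fun i _ => by
      simpa using mul_self_nonneg (ψ i ⬝ᵥ u)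
  have h2 : 0 ≤ r ⬝ᵥ r := by simpa using dotProduct_self_star_nonneg r
  rw [hw]
  simp only [add_dotProduct, dotProduct_add, dotProduct_comm u r]
  linarith

/-- Confidence bound for the posterior mean, at the feature `v`, of the parameter `w` observed with
noise `ζ`. -/
lemma abs_posteriorMean_sub_le (ψ : ℕ → ι → ℝ) (ζ : ℕ → ℝ) (n : ℕ) (v w : ι → ℝ) :
    |v ⬝ᵥ (precision ψ n)⁻¹ *ᵥ (∑ i ∈ Finset.range n, (ψ i ⬝ᵥ w + ζ i) • ψ i) - v ⬝ᵥ w| ≤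
      √(v ⬝ᵥ (precision ψ n)⁻¹ *ᵥ v) *
        (√(w ⬝ᵥ w) + √(score ψ ζ n ⬝ᵥ (precision ψ n)⁻¹ *ᵥ score ψ ζ n)) := by
  have hp := (posDef_precision ψ n).inv.posSemidef
  -- Thus the posterior mean minus `w` is `V⁻¹ (S - w)`, and Cauchy–Schwarz for the form `V⁻¹`
  -- applies to each of the two terms.
  have h1 : (∑ i ∈ Finset.range n, (ψ i ⬝ᵥ w + ζ i) • ψ i) =
      precision ψ n *ᵥ w - w + score ψ ζ n := by
    rw [precision_mulVec, score]
    simp [add_smul, Finset.sum_add_distrib]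
  have h2 : (precision ψ n)⁻¹ *ᵥ (precision ψ n *ᵥ w) = w :=
    inv_mulVec_eq_of_mulVec_eq (posDef_precision ψ n) rfl
  rw [h1, mulVec_add, mulVec_sub, h2, dotProduct_add, dotProduct_sub]
  have h3 := abs_dotProduct_mulVec_le hp v w
  have h4 := abs_dotProduct_mulVec_le hp v (score ψ ζ n)
  have h5 : √(v ⬝ᵥ (precision ψ n)⁻¹ *ᵥ v) * √(w ⬝ᵥ (precision ψ n)⁻¹ *ᵥ w) ≤
      √(v ⬝ᵥ (precision ψ n)⁻¹ *ᵥ v) * √(w ⬝ᵥ w) :=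
    mul_le_mul_of_nonneg_left (Real.sqrt_le_sqrt (quadForm_inv_precision_le ψ n w))
      (Real.sqrt_nonneg _)
  rw [abs_le] at *
  constructor <;> linarith

/-- The posterior covariance in feature space agrees with the one computed from the Gram matrix. -/
lemma gram_posterior (ψ : ℕ → ι → ℝ) (n : ℕ) (G : Matrix (Fin n) (Fin n) ℝ)
    (hG : ∀ i j, G i j = ψ i ⬝ᵥ ψ j) (y : Fin n → ℝ) :
    (precision ψ n)⁻¹ *ᵥ (∑ i : Fin n, y i • ψ i) = ∑ i : Fin n, ((1 + G)⁻¹ *ᵥ y) i • ψ i := by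
  set F : Matrix (Fin n) ι ℝ := of fun i => ψ i with hF
  have hG' : G = F * Fᵀ := by
    ext i j
    simp [hG, hF, mul_apply, dotProduct]
  have hW : precision ψ n = 1 + Fᵀ * F := by
    ext a b
    simp [precision, hF, mul_apply, vecMulVec_apply, Finset.sum_range, Matrix.sum_apply]
  have hs : ∀ x : Fin n → ℝ, ∑ i : Fin n, x i • ψ i = Fᵀ *ᵥ x := by
    intro x
    ext a
    simp [hF, mulVec, dotProduct, mul_comm]
  have hpd : (1 + G).PosDef := by
    rw [hG']
    exact PosDef.one.add_posSemidef
      (by simpa [conjTranspose_eq_transpose_of_trivial] using posSemidef_self_mul_conjTranspose F)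
  rw [hs, hs]
  apply inv_mulVec_eq_of_mulVec_eq (posDef_precision ψ n)
  conv_rhs => rw [← mulVec_inv_mulVec hpd y]
  -- The push-through identity moves the inverse from feature space to the Gram matrix.
  have hcomm : (1 + Fᵀ * F) * Fᵀ = Fᵀ * (1 + F * Fᵀ) := by
    rw [Matrix.add_mul, Matrix.mul_add, Matrix.mul_one, Matrix.one_mul, Matrix.mul_assoc]
  rw [hW, mulVec_mulVec _ _ Fᵀ, hcomm, ← hG', ← mulVec_mulVec]

lemma det_one_add_gram (ψ : ℕ → ι → ℝ) (n : ℕ) (G : Matrix (Fin n) (Fin n) ℝ)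
    (hG : ∀ i j, G i j = ψ i ⬝ᵥ ψ j) : (1 + G).det = (precision ψ n).det := by
  set F : Matrix (Fin n) ι ℝ := of fun i => ψ i with hF
  have hG' : G = F * Fᵀ := by
    ext i j
    simp [hG, hF, mul_apply, dotProduct]
  have hW : precision ψ n = 1 + Fᵀ * F := by
    ext a b
    simp [precision, hF, mul_apply, vecMulVec_apply, Finset.sum_range, Matrix.sum_apply]
  rw [hG', hW, det_one_add_mul_comm]

end LinearRegression

end

noncomputable section

/-! ### A maximal inequality for mixtures of exponential supermartingales -/

open scoped ENNReal

section CondSubGaussian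

variable {Ω : Type*} {m mΩ : MeasurableSpace Ω} {P : Measure Ω}

/-- Restricted to `m`, the measure with density `f` is at most `C • P`; integrating the
`m`-measurable `W` against both needs no integrability of `W`. -/
lemma lintegral_mul_le_of_condExp_le [IsProbabilityMeasure P] (hm : m ≤ mΩ) {f : Ω → ℝ} {C : ℝ}
    (hfm : Measurable f) (hf : Integrable f P) (hf0 : 0 ≤ f) (hC : P[f | m] ≤ᵐ[P] fun _ => C)
    {W : Ω → ℝ≥0∞} (hW : Measurable[m] W) :
    ∫⁻ ω, W ω * ENNReal.ofReal (f ω) ∂P ≤ ENNReal.ofReal C * ∫⁻ ω, W ω ∂P := by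
  have hle : (P.withDensity fun ω => ENNReal.ofReal (f ω)).trim hm ≤
      ENNReal.ofReal C • P.trim hm := by
    refine Measure.le_intro fun A hA _ => ?_
    rw [trim_measurableSet_eq hm hA, withDensity_apply _ (hm _ hA), Measure.smul_apply,
      trim_measurableSet_eq hm hA, smul_eq_mul,
      ← ofReal_integral_eq_lintegral_ofReal hf.integrableOn (Eventually.of_forall hf0),
      ← setIntegral_condExp hm hf hA]
    have h1 : ∫ ω in A, (P[f | m]) ω ∂P ≤ ∫ _ in A, C ∂P :=
      setIntegral_mono_ae integrable_condExp.integrableOn (integrableOn_const (by simp)) hC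
    have hC0 : 0 ≤ C := by
      obtain ⟨ω, h2, h3⟩ := (hC.and (condExp_nonneg (m := m) (μ := P)
        (Eventually.of_forall hf0))).exists
      exact le_trans h3 h2
    refine (ENNReal.ofReal_le_ofReal h1).trans ?_
    rw [setIntegral_const, smul_eq_mul, mul_comm, ENNReal.ofReal_mul hC0, ofReal_measureReal]
  calc ∫⁻ ω, W ω * ENNReal.ofReal (f ω) ∂P
      = ∫⁻ ω, W ω ∂(P.withDensity fun ω => ENNReal.ofReal (f ω)) := by
        rw [lintegral_withDensity_eq_lintegral_mul _ hfm.ennreal_ofReal (hW.mono hm le_rfl)]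
        simp [mul_comm]
    _ = ∫⁻ ω, W ω ∂((P.withDensity fun ω => ENNReal.ofReal (f ω)).trim hm) :=
        (lintegral_trim hm hW).symm
    _ ≤ ∫⁻ ω, W ω ∂(ENNReal.ofReal C • P.trim hm) := lintegral_mono' hle le_rfl
    _ = ENNReal.ofReal C * ∫⁻ ω, W ω ∂P := by
        rw [lintegral_smul_measure, lintegral_trim hm hW, smul_eq_mul]

variable [IsProbabilityMeasure P] (hm : m ≤ mΩ) {ζ : Ω → ℝ} (hζ : Measurable ζ)
  (hsG : ∀ s : ℝ, Integrable (fun ω => Real.exp (s * ζ ω)) P ∧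
    P[fun ω => Real.exp (s * ζ ω) | m] ≤ᵐ[P] fun _ => Real.exp (s ^ 2 / 2))
  {W : Ω → ℝ≥0∞} (hW : Measurable[m] W)

include hm hζ hsG hW

lemma lintegral_mul_exp_const_le (s : ℝ) :
    ∫⁻ ω, W ω * ENNReal.ofReal (Real.exp (s * ζ ω - s ^ 2 / 2)) ∂P ≤ ∫⁻ ω, W ω ∂P := by
  have h := lintegral_mul_le_of_condExp_le hm ((hζ.const_mul s).exp) (hsG s).1
    (fun ω => (Real.exp_pos _).le) (hsG s).2
    (W := fun ω => W ω * ENNReal.ofReal (Real.exp (-(s ^ 2 / 2)))) (hW.mul_const _)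
  have h1 : ∀ ω, W ω * ENNReal.ofReal (Real.exp (s * ζ ω - s ^ 2 / 2)) =
      W ω * ENNReal.ofReal (Real.exp (-(s ^ 2 / 2))) * ENNReal.ofReal (Real.exp (s * ζ ω)) := by
    intro ω
    rw [mul_assoc, ← ENNReal.ofReal_mul (Real.exp_pos _).le, ← Real.exp_add]
    ring_nf
  simp_rw [h1]
  refine h.trans (le_of_eq ?_)
  rw [lintegral_mul_const _ (hW.mono hm le_rfl), mul_comm, mul_assoc,
    ← ENNReal.ofReal_mul (Real.exp_pos _).le, ← Real.exp_add]
  simp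

lemma lintegral_mul_exp_le_of_finite_range {f : Ω → ℝ} (hf : Measurable[m] f)
    (hfin : (Set.range f).Finite) :
    ∫⁻ ω, W ω * ENNReal.ofReal (Real.exp (f ω * ζ ω - f ω ^ 2 / 2)) ∂P ≤ ∫⁻ ω, W ω ∂P := by
  classical
  have hind : ∀ c : ℝ, Measurable[m] ((f ⁻¹' {c}).indicator W) := fun c =>
    hW.indicator (hf (measurableSet_singleton c))
  have hsum : ∀ g : ℝ → Ω → ℝ≥0∞, ∀ ω,
      W ω * g (f ω) ω = ∑ c ∈ hfin.toFinset, (f ⁻¹' {c}).indicator W ω * g c ω := by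
    intro g ω
    rw [Finset.sum_eq_single (f ω)]
    · simp
    · intro c _ hc
      rw [Set.indicator_of_notMem (fun h => hc (by simpa using h.symm)), zero_mul]
    · intro h
      exact absurd (by simp) h
  have hW' : ∀ ω, W ω = ∑ c ∈ hfin.toFinset, (f ⁻¹' {c}).indicator W ω := by
    intro ω
    simpa using hsum (fun _ _ => 1) ω
  rw [lintegral_congr (hsum fun c ω => ENNReal.ofReal (Real.exp (c * ζ ω - c ^ 2 / 2))),
    lintegral_congr hW', lintegral_finsetSum _ fun c _ => ?_,
    lintegral_finsetSum _ fun c _ => (hind c).mono hm le_rfl]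
  · exact Finset.sum_le_sum fun c _ => lintegral_mul_exp_const_le hm hζ hsG (hind c) c
  · exact ((hind c).mono hm le_rfl).mul (by fun_prop)

/-- The exponent may depend on the past. Exponents with finite range split into level sets on which
they are constant; Fatou along simple approximations gives the general case, as only an upper bound
is needed. -/
lemma lintegral_mul_exp_le {l : Ω → ℝ} (hl : Measurable[m] l) :
    ∫⁻ ω, W ω * ENNReal.ofReal (Real.exp (l ω * ζ ω - l ω ^ 2 / 2)) ∂P ≤ ∫⁻ ω, W ω ∂P := by
  have hs : StronglyMeasurable[m] l := hl.stronglyMeasurable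
  have hlim : ∀ ω, Tendsto
      (fun j => W ω * ENNReal.ofReal (Real.exp (hs.approx j ω * ζ ω - hs.approx j ω ^ 2 / 2)))
      atTop (𝓝 (W ω * ENNReal.ofReal (Real.exp (l ω * ζ ω - l ω ^ 2 / 2)))) := by
    intro ω
    refine ENNReal.Tendsto.const_mul ?_ (Or.inl ?_)
    · have h := hs.tendsto_approx ω
      exact ENNReal.tendsto_ofReal ((Real.continuous_exp.tendsto _).comp
        ((h.mul_const _).sub ((h.pow 2).div_const 2)))
    · simpa using Real.exp_pos _
  calc ∫⁻ ω, W ω * ENNReal.ofReal (Real.exp (l ω * ζ ω - l ω ^ 2 / 2)) ∂P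
      = ∫⁻ ω, liminf (fun j => W ω * ENNReal.ofReal
          (Real.exp (hs.approx j ω * ζ ω - hs.approx j ω ^ 2 / 2))) atTop ∂P :=
        lintegral_congr fun ω => (hlim ω).liminf_eq.symm
    _ ≤ liminf (fun j => ∫⁻ ω, W ω * ENNReal.ofReal
          (Real.exp (hs.approx j ω * ζ ω - hs.approx j ω ^ 2 / 2)) ∂P) atTop := by
        refine lintegral_liminf_le fun j => ?_
        have : Measurable (hs.approx j) :=
          (@SimpleFunc.measurable _ _ m _ (hs.approx j)).mono hm le_rfl
        exact (hW.mono hm le_rfl).mul (by fun_prop)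
    _ ≤ liminf (fun _ : ℕ => ∫⁻ ω, W ω ∂P) atTop :=
        liminf_le_liminf (Eventually.of_forall fun j =>
          lintegral_mul_exp_le_of_finite_range hm hζ hsG hW
            (@SimpleFunc.measurable _ _ m _ (hs.approx j)) (@SimpleFunc.finite_range _ _ m (hs.approx j)))
    _ = ∫⁻ ω, W ω ∂P := liminf_const _

-- Completing the square: the integrand is the mixture factor times the Gaussian density with mean
-- `√s (z - a) / (1 + s)` and variance `(1 + s)⁻¹`.
omit hm hζ hsG hW [IsProbabilityMeasure P] in
lemma ofReal_mixtureFactor (a s z : ℝ) (hs : 0 ≤ s) :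
    ENNReal.ofReal (LinearRegression.mixtureFactor a s z) =
      ∫⁻ x, gaussianPDF 0 1 x *
        ENNReal.ofReal (Real.exp ((a + √s * x) * z - (a + √s * x) ^ 2 / 2)) := by
  have hv : (0 : ℝ) < (1 + s)⁻¹ := by positivity
  have hpt : ∀ x, gaussianPDF 0 1 x *
      ENNReal.ofReal (Real.exp ((a + √s * x) * z - (a + √s * x) ^ 2 / 2)) =
      ENNReal.ofReal (LinearRegression.mixtureFactor a s z) *
        gaussianPDF (√s * (z - a) / (1 + s)) (1 + s)⁻¹.toNNReal x := by
    intro x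
    have hm0 : 0 ≤ LinearRegression.mixtureFactor a s z := by
      unfold LinearRegression.mixtureFactor; positivity
    rw [gaussianPDF_def, gaussianPDF_def, ← ENNReal.ofReal_mul (gaussianPDFReal_nonneg _ _ _),
      ← ENNReal.ofReal_mul hm0]
    congr 1
    simp only [gaussianPDFReal_def, LinearRegression.mixtureFactor, Real.coe_toNNReal _ hv.le, NNReal.coe_one]
    have h1 : √(2 * Real.pi * (1 + s)⁻¹) = √(2 * Real.pi * 1) / √(1 + s) := by
      rw [← Real.sqrt_div (by positivity)]
      congr 1
      field_simp
    have h2 : 0 < √(1 + s) := Real.sqrt_pos.2 (by linarith)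
    rw [h1, mul_assoc, ← Real.exp_add]
    have h3 : -(x - 0) ^ 2 / (2 * 1) + ((a + √s * x) * z - (a + √s * x) ^ 2 / 2) =
        (2 * z * a + z ^ 2 * s - a ^ 2) / (2 * (1 + s)) +
          -(x - √s * (z - a) / (1 + s)) ^ 2 / (2 * (1 + s)⁻¹) := by
      have h4 : √s ^ 2 = s := Real.sq_sqrt hs
      set r := √s
      rw [← h4]
      have : (0 : ℝ) < 1 + r ^ 2 := by positivity
      field_simp
      ring
    rw [h3, Real.exp_add]
    field_simp
  have hv' : (1 + s)⁻¹.toNNReal ≠ 0 := (Real.toNNReal_pos.2 hv).ne'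
  rw [lintegral_congr hpt, lintegral_const_mul _ (measurable_gaussianPDF _ _),
    lintegral_gaussianPDF_eq_one _ hv', mul_one]

/-- By Tonelli, the factor averages exponentials whose exponents `a + √s * x` are known from the
past for each fixed `x`. -/
lemma lintegral_mul_mixtureFactor_le {a s : Ω → ℝ} (ha : Measurable[m] a) (hs : Measurable[m] s)
    (hs0 : ∀ ω, 0 ≤ s ω) :
    ∫⁻ ω, W ω * ENNReal.ofReal (LinearRegression.mixtureFactor (a ω) (s ω) (ζ ω)) ∂P ≤
      ∫⁻ ω, W ω ∂P := by
  have ha' : Measurable a := ha.mono hm le_rfl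
  have hs' : Measurable s := hs.mono hm le_rfl
  have hW' : Measurable W := hW.mono hm le_rfl
  have hpdf := measurable_gaussianPDF 0 1
  have hrw : ∀ ω, W ω * ENNReal.ofReal (LinearRegression.mixtureFactor (a ω) (s ω) (ζ ω)) =
      ∫⁻ x, gaussianPDF 0 1 x * (W ω * ENNReal.ofReal
        (Real.exp ((a ω + √(s ω) * x) * ζ ω - (a ω + √(s ω) * x) ^ 2 / 2))) := by
    intro ω
    rw [ofReal_mixtureFactor _ _ _ (hs0 ω), ← lintegral_const_mul _ (by fun_prop)]
    exact lintegral_congr fun x => by ring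
  rw [lintegral_congr hrw, lintegral_lintegral_swap (by fun_prop)]
  calc ∫⁻ x, ∫⁻ ω, gaussianPDF 0 1 x * (W ω * ENNReal.ofReal
        (Real.exp ((a ω + √(s ω) * x) * ζ ω - (a ω + √(s ω) * x) ^ 2 / 2))) ∂P
      ≤ ∫⁻ x, gaussianPDF 0 1 x * ∫⁻ ω, W ω ∂P := by
        refine lintegral_mono fun x => ?_
        rw [lintegral_const_mul _ (by fun_prop)]
        refine mul_le_mul' le_rfl ?_
        exact lintegral_mul_exp_le hm hζ hsG hW (ha.add (hs.sqrt.mul_const x))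
    _ = ∫⁻ ω, W ω ∂P := by
        rw [lintegral_mul_const _ hpdf, lintegral_gaussianPDF_eq_one _ one_ne_zero, one_mul]

end CondSubGaussian

/-- Ville's maximal inequality for nonnegative supermartingales. -/
lemma mul_measure_exists_le_of_supermartingale {Ω : Type*} {mΩ : MeasurableSpace Ω} {P : Measure Ω}
    (ℱ : Filtration ℕ mΩ) {X : ℕ → Ω → ℝ≥0∞} (hX : ∀ n, Measurable[ℱ n] (X n))
    (h : ∀ n A, MeasurableSet[ℱ n] A → ∫⁻ ω in A, X (n + 1) ω ∂P ≤ ∫⁻ ω in A, X n ω ∂P)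
    (c : ℝ≥0∞) :
    c * P {ω | ∃ n, c ≤ X n ω} ≤ ∫⁻ ω, X 0 ω ∂P := by
  set A : ℕ → Set Ω := fun N => {ω | ∃ n ≤ N, c ≤ X n ω} with hA
  have hAm : ∀ N, MeasurableSet[ℱ N] (A N) := by
    intro N
    have : A N = ⋃ n ∈ Set.Iic N, {ω | c ≤ X n ω} := by ext; simp [hA]
    rw [this]
    exact MeasurableSet.biUnion (Set.to_countable _) fun n hn =>
      ℱ.mono hn _ (measurableSet_le measurable_const (hX n))
  have hmono : Monotone A := fun N N' hN ω ⟨n, hn, hc⟩ => ⟨n, hn.trans hN, hc⟩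
  -- This is the process stopped at its first crossing of `c`: the crossed part contributes at least
  -- `c` times its mass, the rest keeps running.
  have key : ∀ N, c * P (A N) + ∫⁻ ω in (A N)ᶜ, X N ω ∂P ≤ ∫⁻ ω, X 0 ω ∂P := by
    intro N
    induction N with
    | zero =>
      rw [← lintegral_add_compl (μ := P) (X 0) (ℱ.le _ _ (hAm 0))]
      refine add_le_add ?_ le_rfl
      rw [← setLIntegral_const]
      refine setLIntegral_mono' (ℱ.le _ _ (hAm 0)) fun ω ⟨n, hn, hc⟩ => ?_
      obtain rfl : n = 0 := by omega
      exact hc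
    | succ N ih =>
      refine le_trans ?_ ih
      have h1 := h N (A N)ᶜ (hAm N).compl
      have hd : MeasurableSet (A (N + 1) \ A N) :=
        (ℱ.le _ _ (hAm (N + 1))).diff (ℱ.le _ _ (hAm N))
      have hsplit : (A N)ᶜ = (A (N + 1) \ A N) ∪ (A (N + 1))ᶜ := by
        ext ω
        have := @hmono N (N + 1) (Nat.le_succ N) ω
        simp only [Set.mem_compl_iff, Set.mem_union, Set.mem_sdiff]
        tauto
      have hdisj : Disjoint (A (N + 1) \ A N) (A (N + 1))ᶜ :=
        Set.disjoint_left.2 fun ω h1 h2 => h2 h1.1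
      have h2 : ∫⁻ ω in (A N)ᶜ, X (N + 1) ω ∂P = ∫⁻ ω in A (N + 1) \ A N, X (N + 1) ω ∂P +
          ∫⁻ ω in (A (N + 1))ᶜ, X (N + 1) ω ∂P := by
        rw [hsplit, lintegral_union (ℱ.le _ _ (hAm (N + 1))).compl hdisj]
      have h3 : c * P (A (N + 1) \ A N) ≤ ∫⁻ ω in A (N + 1) \ A N, X (N + 1) ω ∂P := by
        rw [← setLIntegral_const]
        refine setLIntegral_mono' hd fun ω ⟨⟨n, hn, hc⟩, hnot⟩ => ?_
        obtain rfl : n = N + 1 := by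
          by_contra hne
          exact hnot ⟨n, by omega, hc⟩
        exact hc
      have h4 : P (A (N + 1)) = P (A N) + P (A (N + 1) \ A N) := by
        rw [← measure_union Set.disjoint_sdiff_right hd,
          Set.union_sdiff_cancel (hmono (Nat.le_succ N))]
      calc c * P (A (N + 1)) + ∫⁻ ω in (A (N + 1))ᶜ, X (N + 1) ω ∂P
          = c * P (A N) + (c * P (A (N + 1) \ A N) +
              ∫⁻ ω in (A (N + 1))ᶜ, X (N + 1) ω ∂P) := by rw [h4]; ring
        _ ≤ c * P (A N) + ∫⁻ ω in (A N)ᶜ, X (N + 1) ω ∂P := by rw [h2]; gcongr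
        _ ≤ c * P (A N) + ∫⁻ ω in (A N)ᶜ, X N ω ∂P := by gcongr
  have hU : {ω | ∃ n, c ≤ X n ω} = ⋃ N, A N := by
    ext ω
    simp only [hA, Set.mem_ofPred_eq, Set.mem_iUnion]
    exact ⟨fun ⟨n, hn⟩ => ⟨n, n, le_rfl, hn⟩, fun ⟨_, n, _, hn⟩ => ⟨n, hn⟩⟩
  rw [hU, hmono.measure_iUnion, ENNReal.mul_iSup]
  exact iSup_le fun N => le_self_add.trans (key N)

end

/-! ### Time-uniform bound for the mixture, and finite features of an RKHS -/

noncomputable section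

open scoped ENNReal

namespace LinearRegression

open Matrix

set_option linter.unusedSectionVars false

variable {ι : Type*} [Fintype ι] [DecidableEq ι]

section Measurability

variable {Ω : Type*} [MeasurableSpace Ω]

lemma measurable_matrix_det {A : Ω → Matrix ι ι ℝ} (hA : ∀ i j, Measurable fun ω => A ω i j) :
    Measurable fun ω => (A ω).det := by
  simp_rw [det_apply]
  exact Finset.measurable_sum _ fun σ _ =>
    (Finset.measurable_prod _ fun i _ => hA _ _).const_smul _

lemma measurable_matrix_inv {A : Ω → Matrix ι ι ℝ} (hA : ∀ i j, Measurable fun ω => A ω i j)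
    (i j : ι) : Measurable fun ω => (A ω)⁻¹ i j := by
  simp only [inv_def, Matrix.smul_apply, Ring.inverse_eq_inv', smul_eq_mul, adjugate_apply]
  refine (measurable_matrix_det hA).inv.mul (measurable_matrix_det fun a b => ?_)
  by_cases h : a = j
  · subst h
    simp
  · simpa [h] using hA a b

lemma measurable_precision_apply {ψ : ℕ → Ω → ι → ℝ} {n : ℕ}
    (hψ : ∀ i < n, Measurable (ψ i)) (a b : ι) :
    Measurable fun ω => precision (fun i => ψ i ω) n a b := by
  simp only [precision, Matrix.add_apply, Matrix.sum_apply, vecMulVec_apply]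
  refine measurable_const.add (Finset.measurable_sum _ fun i hi => ?_)
  have := hψ i (Finset.mem_range.1 hi)
  fun_prop

lemma measurable_score {ψ : ℕ → Ω → ι → ℝ} {ζ : ℕ → Ω → ℝ} {n : ℕ}
    (hψ : ∀ i < n, Measurable (ψ i)) (hζ : ∀ i < n, Measurable (ζ i)) :
    Measurable fun ω => score (fun i => ψ i ω) (fun i => ζ i ω) n := by
  refine Finset.measurable_sum _ fun i hi => ?_
  have := hψ i (Finset.mem_range.1 hi)
  have := hζ i (Finset.mem_range.1 hi)
  fun_prop

lemma measurable_dotProduct_mulVec {A : Ω → Matrix ι ι ℝ} {v w : Ω → ι → ℝ}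
    (hA : ∀ i j, Measurable fun ω => A ω i j) (hv : Measurable v) (hw : Measurable w) :
    Measurable fun ω => v ω ⬝ᵥ A ω *ᵥ w ω := by
  simp only [dotProduct, mulVec]
  fun_prop

end Measurability

lemma measure_mixture_ge_le {Ω : Type*} {mΩ : MeasurableSpace Ω} {P : Measure Ω}
    [IsProbabilityMeasure P] (ℱ : Filtration ℕ mΩ) {ψ : ℕ → Ω → ι → ℝ} {ζ : ℕ → Ω → ℝ}
    (hψ : ∀ n, Measurable[ℱ n] (ψ n)) (hζ : ∀ n, Measurable[ℱ (n + 1)] (ζ n))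
    (hsG : ∀ (n : ℕ) (s : ℝ), Integrable (fun ω => Real.exp (s * ζ n ω)) P ∧
      P[fun ω => Real.exp (s * ζ n ω) | ℱ n] ≤ᵐ[P] fun _ => Real.exp (s ^ 2 / 2))
    {δ : ℝ} (hδ : 0 < δ) :
    MeasurableSet {ω | ∃ n, 1 / δ ≤ mixture (fun i => ψ i ω) (fun i => ζ i ω) n} ∧
    P {ω | ∃ n, 1 / δ ≤ mixture (fun i => ψ i ω) (fun i => ζ i ω) n} ≤ ENNReal.ofReal δ := by
  have hψ' : ∀ n i, i ≤ n → Measurable[ℱ n] (ψ i) := fun n i h => (hψ i).mono (ℱ.mono h) le_rfl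
  have hζ' : ∀ n i, i < n → Measurable[ℱ n] (ζ i) := fun n i h => (hζ i).mono (ℱ.mono h) le_rfl
  have hinv : ∀ n a b, Measurable[ℱ n] fun ω => (precision (fun i => ψ i ω) n)⁻¹ a b := fun n =>
    @measurable_matrix_inv ι _ _ Ω (ℱ n) _
      (@measurable_precision_apply ι _ _ Ω (ℱ n) _ _ fun i hi => hψ' n i hi.le)
  have hscore : ∀ n, Measurable[ℱ n] fun ω => score (fun i => ψ i ω) (fun i => ζ i ω) n := fun n =>
    @measurable_score ι _ _ Ω (ℱ n) _ _ _ (fun i hi => hψ' n i hi.le) (fun i hi => hζ' n i hi)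
  have hvar : ∀ n, Measurable[ℱ n] fun ω => predVar (fun i => ψ i ω) n := fun n =>
    @measurable_dotProduct_mulVec ι _ _ Ω (ℱ n) _ _ _ (hinv n) (hψ n) (hψ n)
  have hmean : ∀ n, Measurable[ℱ n] fun ω => predMean (fun i => ψ i ω) (fun i => ζ i ω) n :=
    fun n => @measurable_dotProduct_mulVec ι _ _ Ω (ℱ n) _ _ _ (hinv n) (hψ n) (hscore n)
  have hmix : ∀ n, Measurable[ℱ n] fun ω => mixture (fun i => ψ i ω) (fun i => ζ i ω) n :=
    fun n => ((@measurable_dotProduct_mulVec ι _ _ Ω (ℱ n) _ _ _ (hinv n) (hscore n)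
      (hscore n)).div_const 2).exp.div (@measurable_matrix_det ι _ _ Ω (ℱ n) _
        (@measurable_precision_apply ι _ _ Ω (ℱ n) _ _ fun i hi => hψ' n i hi.le)).sqrt
  have hset : {ω | ∃ n, 1 / δ ≤ mixture (fun i => ψ i ω) (fun i => ζ i ω) n} =
      {ω | ∃ n, ENNReal.ofReal (1 / δ) ≤
        ENNReal.ofReal (mixture (fun i => ψ i ω) (fun i => ζ i ω) n)} := by
    ext ω
    simp only [Set.mem_ofPred_eq]
    exact exists_congr fun n => (ENNReal.ofReal_le_ofReal_iff (mixture_pos _ _ n).le).symm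
  have hville := mul_measure_exists_le_of_supermartingale (P := P) ℱ
    (X := fun n ω => ENNReal.ofReal (mixture (fun i => ψ i ω) (fun i => ζ i ω) n))
    (fun n => (hmix n).ennreal_ofReal) (fun n A hA => by
      have h := lintegral_mul_mixtureFactor_le (P := P) (ℱ.le n)
        ((hζ n).mono (ℱ.le _) le_rfl) (hsG n)
        -- Taking the current mixture on `A` as the weight turns the one-step factor bound into the
        -- supermartingale inequality on `A`.
        (W := A.indicator fun ω => ENNReal.ofReal (mixture (fun i => ψ i ω) (fun i => ζ i ω) n))
        ((hmix n).ennreal_ofReal.indicator hA) (hmean n) (hvar n)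
        (fun ω => predVar_nonneg _ n)
      rw [← lintegral_indicator (ℱ.le _ _ hA), ← lintegral_indicator (ℱ.le _ _ hA)]
      refine le_trans (le_of_eq (lintegral_congr fun ω => ?_)) h
      by_cases hω : ω ∈ A
      · simp only [Set.indicator_of_mem hω]
        rw [mixture_succ, ENNReal.ofReal_mul (mixture_pos _ _ n).le]
      · simp [Set.indicator_of_notMem hω]) (ENNReal.ofReal (1 / δ))
  refine ⟨?_, ?_⟩
  · rw [Set.ofPred_exists]
    exact MeasurableSet.iUnion fun n =>
      measurableSet_le measurable_const ((hmix n).mono (ℱ.le n) le_rfl)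
  · simp only [mixture_zero, ENNReal.ofReal_one, lintegral_const, measure_univ, mul_one] at hville
    rw [← hset] at hville
    set p := P {ω | ∃ n, 1 / δ ≤ mixture (fun i => ψ i ω) (fun i => ζ i ω) n}
    calc p = ENNReal.ofReal δ * (ENNReal.ofReal (1 / δ) * p) := by
          rw [← mul_assoc, ← ENNReal.ofReal_mul hδ.le, mul_one_div_cancel hδ.ne',
            ENNReal.ofReal_one, one_mul]
      _ ≤ ENNReal.ofReal δ * 1 := by gcongr
      _ = ENNReal.ofReal δ := mul_one _

end LinearRegression

/-- An element of a reproducing kernel Hilbert space on a finite domain is a linear function of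
finite-dimensional features that represent the kernel. -/
lemma RKHS.exists_finite_features {X : Type*} [Finite X] {H : Type*} [NormedAddCommGroup H]
    [InnerProductSpace ℝ H] [CompleteSpace H] [RKHS ℝ H X ℝ] (q : H) :
    ∃ (N : ℕ) (φ : X → Fin N → ℝ) (w : Fin N → ℝ),
      (∀ a b, φ a ⬝ᵥ φ b = RKHS.kernel H a b 1) ∧ (∀ a, φ a ⬝ᵥ w = q a) ∧ √(w ⬝ᵥ w) ≤ ‖q‖ := by
  classical
  -- Projecting `q` onto the span of the kernel sections keeps all its values, by the reproducing
  -- property, and does not increase its norm. Coordinates in an orthonormal basis of the span are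
  -- the features.
  let F : Submodule ℝ H := Submodule.span ℝ (Set.range fun x : X => RKHS.kerFun H x (1 : ℝ))
  have : FiniteDimensional ℝ F := FiniteDimensional.span_of_finite ℝ (Set.finite_range _)
  let b := stdOrthonormalBasis ℝ F
  have hmem : ∀ x : X, RKHS.kerFun H x (1 : ℝ) ∈ F := fun x =>
    Submodule.subset_span (Set.mem_range_self x)
  have hdot : ∀ u v : F, (fun i => inner ℝ (b i) u) ⬝ᵥ (fun i => inner ℝ (b i) v) =
      inner ℝ u v := by
    intro u v
    rw [← b.sum_inner_mul_inner u v]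
    exact Finset.sum_congr rfl fun i _ => by rw [real_inner_comm]
  refine ⟨_, fun x i => inner ℝ (b i) ⟨_, hmem x⟩,
    fun i => inner ℝ (b i) (F.orthogonalProjectionOnto q), fun x y => ?_, fun x => ?_, ?_⟩
  · rw [hdot, Submodule.coe_inner]
    simp only
    rw [RKHS.kerFun_inner, RKHS.kerFun_apply]
    simp
  · rw [hdot, F.inner_orthogonalProjectionOnto_eq_of_mem_left]
    simp
  · rw [hdot, real_inner_self_eq_norm_sq, Real.sqrt_sq (norm_nonneg _)]
    exact F.norm_orthogonalProjectionOnto_apply_le q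

end

/-! ### Gaussian process posterior in feature coordinates -/

noncomputable section

namespace TuningProblem

open Matrix LinearRegression

set_option linter.unusedSectionVars false

variable {p : ℕ} (c : TuningProblem p)

section Features

variable {ι : Type*} [Fintype ι] [DecidableEq ι] {φ : c.D → ι → ℝ}
  (hφ : ∀ a b, φ a ⬝ᵥ φ b = c.k a b) (θ : ℕ → c.D)

/-- The features of the evaluated parameters, scaled to unit noise. -/
def scaledFeature {ι : Type*} (φ : c.D → ι → ℝ) (θ : ℕ → c.D) (n : ℕ) : ι → ℝ := c.σ⁻¹ • φ (θ n)

include hφ in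
lemma regCov_eq (n : ℕ) : c.regCov θ n =
    c.σ ^ 2 • (1 + of fun i j : Fin n => c.scaledFeature φ θ i ⬝ᵥ c.scaledFeature φ θ j) := by
  have := c.σ_pos
  ext i j
  simp only [regCov, cov, scaledFeature, Matrix.add_apply, Matrix.smul_apply, of_apply,
    smul_dotProduct, dotProduct_smul, hφ, smul_eq_mul]
  field_simp
  ring

-- The bridge from kernel to feature expressions: taking `y` as the measurements gives the mean,
-- taking it as a kernel vector gives the covariance.
include hφ in
lemma kvec_dotProduct_regCov_inv (n : ℕ) (x : c.D) (y : Fin n → ℝ) :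
    c.kvec θ n x ⬝ᵥ (c.regCov θ n)⁻¹ *ᵥ y = φ x ⬝ᵥ (precision (c.scaledFeature φ θ) n)⁻¹ *ᵥ
      ∑ i : Fin n, (c.σ⁻¹ * y i) • c.scaledFeature φ θ i := by
  have hσ := c.σ_pos
  set G : Matrix (Fin n) (Fin n) ℝ :=
    of fun i j : Fin n => c.scaledFeature φ θ i ⬝ᵥ c.scaledFeature φ θ j with hG
  have hinv : (c.regCov θ n)⁻¹ = (c.σ ^ 2)⁻¹ • (1 + G)⁻¹ := by
    have hdet : IsUnit (1 + G).det := by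
      rw [det_one_add_gram (c.scaledFeature φ θ) n G fun i j => rfl]
      exact (posDef_precision _ n).det_pos.ne'.isUnit
    rw [c.regCov_eq hφ θ n]
    exact inv_smul' _ (Units.mk0 (c.σ ^ 2) (by positivity)) hdet
  rw [gram_posterior (c.scaledFeature φ θ) n G (fun i j => rfl) fun i => c.σ⁻¹ * y i, hinv]
  have hy : (fun i => c.σ⁻¹ * y i) = c.σ⁻¹ • y := rfl
  rw [hy, mulVec_smul, smul_mulVec]
  have hsymm : ∀ i : Fin n, c.kvec θ n x i = c.k x (θ i) := fun i => by
    rw [kvec, ← hφ, ← hφ, dotProduct_comm]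
  rw [dotProduct_sum]
  simp only [dotProduct_smul, scaledFeature, hφ, smul_eq_mul, Pi.smul_apply]
  simp only [dotProduct, hsymm]
  rw [Finset.mul_sum]
  refine Finset.sum_congr rfl fun i _ => ?_
  field_simp

include hφ in
lemma postCov_eq (n : ℕ) (x x' : c.D) :
    c.postCov θ n x x' = φ x ⬝ᵥ (precision (c.scaledFeature φ θ) n)⁻¹ *ᵥ φ x' := by
  have h : ∑ i : Fin n, (c.σ⁻¹ * c.kvec θ n x' i) • c.scaledFeature φ θ i =
      precision (c.scaledFeature φ θ) n *ᵥ φ x' - φ x' := by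
    rw [precision_mulVec, add_sub_cancel_left, Finset.sum_range]
    refine Finset.sum_congr rfl fun i _ => ?_
    simp [kvec, scaledFeature, ← hφ]
  rw [postCov, c.kvec_dotProduct_regCov_inv hφ, h, mulVec_sub, dotProduct_sub,
    inv_mulVec_eq_of_mulVec_eq (posDef_precision _ n) rfl, hφ]
  ring

include hφ in
lemma mean_eq (y : ℕ → ℝ) (n : ℕ) (x : c.D) :
    c.mean θ y n x = φ x ⬝ᵥ (precision (c.scaledFeature φ θ) n)⁻¹ *ᵥ
      ∑ i ∈ Finset.range n, (c.σ⁻¹ * y i) • c.scaledFeature φ θ i := by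
  rw [mean, c.kvec_dotProduct_regCov_inv hφ, Finset.sum_range]

-- The factors `2πe` and `σ ^ 2` occur in both entropies and cancel, leaving the determinant of `1 +
-- Gram`.
include hφ in
lemma mutualInfo_eq (n : ℕ) : c.mutualInfo (fun i : Fin n => θ i) =
    Real.log (precision (c.scaledFeature φ θ) n).det / 2 := by
  have hσ := c.σ_pos
  have hreg := c.regCov_eq hφ θ n
  rw [regCov] at hreg
  have hd := (posDef_precision (c.scaledFeature φ θ) n).det_pos
  have hpi := Real.pi_pos
  have hdet := det_one_add_gram (c.scaledFeature φ θ) n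
    (of fun i j : Fin n => c.scaledFeature φ θ i ⬝ᵥ c.scaledFeature φ θ j) fun _ _ => rfl
  rw [mutualInfo, gaussianEntropy, gaussianEntropy, hreg, det_smul, det_smul, det_smul, det_smul,
    hdet, det_one, ← mul_assoc, mul_one,
    Real.log_mul (by positivity) hd.ne']
  ring

include hφ in
lemma postCov_self_nonneg (n : ℕ) (x : c.D) : 0 ≤ c.postCov θ n x x := by
  rw [c.postCov_eq hφ]
  exact dotProduct_mulVec_self_nonneg (posDef_precision _ n).inv.posSemidef _

include hφ in
lemma postCov_self_le_one (n : ℕ) (x : c.D) : c.postCov θ n x x ≤ 1 := by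
  rw [c.postCov_eq hφ]
  exact (quadForm_inv_precision_le _ n _).trans (hφ x x ▸ c.k_le_one x x)

include hφ in
lemma predVar_eq (n : ℕ) :
    predVar (c.scaledFeature φ θ) n = (c.σ ^ 2)⁻¹ * c.postCov θ n (θ n) (θ n) := by
  rw [c.postCov_eq hφ, predVar]
  simp only [scaledFeature, mulVec_smul, dotProduct_smul, smul_dotProduct, smul_eq_mul]
  ring

end Features

/-! ### Information gain and the number of evaluations -/

section InformationGain

lemma bddAbove_mutualInfo (n : ℕ) : BddAbove
    (Set.range fun A : (m : Fin (n + 1)) × (Fin m → c.D) => c.mutualInfo A.2) :=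
  (Set.finite_range _).bddAbove

lemma mutualInfo_le_γ {m n : ℕ} (h : m ≤ n) (A : Fin m → c.D) : c.mutualInfo A ≤ c.γ n :=
  le_ciSup (c.bddAbove_mutualInfo n) ⟨⟨m, Nat.lt_succ_of_le h⟩, A⟩

lemma γ_mono : Monotone c.γ := by
  intro m n h
  have : Nonempty ((k : Fin (m + 1)) × (Fin k → c.D)) := ⟨⟨0, Fin.elim0⟩⟩
  exact ciSup_le fun A => c.mutualInfo_le_γ (by omega) A.2

lemma mutualInfo_of_isEmpty (A : Fin 0 → c.D) : c.mutualInfo A = 0 := by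
  simp [mutualInfo, gaussianEntropy]

lemma γ_nonneg (n : ℕ) : 0 ≤ c.γ n :=
  (c.mutualInfo_of_isEmpty Fin.elim0).symm.le.trans (c.mutualInfo_le_γ (Nat.zero_le n) Fin.elim0)

lemma γ_zero : c.γ 0 = 0 := by
  refine le_antisymm ?_ (c.γ_nonneg 0)
  have : Nonempty ((k : Fin (0 + 1)) × (Fin k → c.D)) := ⟨⟨0, Fin.elim0⟩⟩
  refine ciSup_le fun ⟨m, A⟩ => ?_
  obtain rfl : m = 0 := Fin.fin_one_eq_zero m
  exact (c.mutualInfo_of_isEmpty A).le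

lemma sqrtβ_mono : Monotone c.sqrtβ := by
  intro m n h
  have := c.γ_mono h
  unfold sqrtβ
  gcongr

lemma log_one_add_inv_sq_pos : 0 < Real.log (1 + (c.σ ^ 2)⁻¹) :=
  Real.log_pos (by have := c.σ_pos; linarith [inv_pos.2 (pow_pos this 2)])

/-- Bernoulli's inequality `(1 + t) ^ s ≤ 1 + t * s`. With `t = σ⁻²` it bounds a variance `s ≤ 1` by
the information it yields; this is the source of the logarithm in `C₁`. -/
lemma mul_log_one_add_le {s t : ℝ} (ht : 0 ≤ t) (hs0 : 0 ≤ s) (hs1 : s ≤ 1) :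
    s * Real.log (1 + t) ≤ Real.log (1 + t * s) := by
  rw [← Real.log_rpow (by linarith)]
  refine Real.log_le_log (by positivity) ?_
  have := rpow_one_add_le_one_add_mul_self (s := t) (by linarith) hs0 hs1
  linarith

/-- The number of measurements at points of uncertainty at least `ε` is bounded by the
information gain. -/
lemma card_mul_sq_le {ι : Type*} [Fintype ι] [DecidableEq ι] {φ : c.D → ι → ℝ}
    (hφ : ∀ a b, φ a ⬝ᵥ φ b = c.k a b) (θ : ℕ → c.D) (n : ℕ)
    (h : ∀ i < n, c.ε ≤ 2 * c.sqrtβ (i + 1) * c.sd θ i (θ i)) :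
    (n : ℝ) * c.ε ^ 2 ≤ c.C₁ * (c.β n * c.γ n) := by
  have hL := c.log_one_add_inv_sq_pos
  set L := Real.log (1 + (c.σ ^ 2)⁻¹)
  have hterm : ∀ i ∈ Finset.range n, c.ε ^ 2 ≤
      4 * c.β n / L * Real.log (1 + predVar (c.scaledFeature φ θ) i) := by
    intro i hi
    have hin := Finset.mem_range.1 hi
    have hs0 := c.postCov_self_nonneg hφ θ i (θ i)
    have hsd : c.sd θ i (θ i) ^ 2 = c.postCov θ i (θ i) (θ i) := Real.sq_sqrt hs0
    -- Monotonicity is applied to `sqrtβ` before squaring, since no sign of `B` is assumed here.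
    have h1 : c.ε ≤ 2 * c.sqrtβ n * c.sd θ i (θ i) := by
      refine (h i hin).trans ?_
      have := c.sqrtβ_mono (show i + 1 ≤ n from hin)
      have h0 : 0 ≤ c.sd θ i (θ i) := Real.sqrt_nonneg _
      gcongr
    have h2 : c.ε ^ 2 ≤ 4 * c.β n * c.postCov θ i (θ i) (θ i) := by
      rw [← hsd, β]
      calc c.ε ^ 2 ≤ (2 * c.sqrtβ n * c.sd θ i (θ i)) ^ 2 := pow_le_pow_left₀ c.ε_pos.le h1 2
        _ = _ := by ring
    have h3 := mul_log_one_add_le (t := (c.σ ^ 2)⁻¹) (by positivity) hs0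
      (c.postCov_self_le_one hφ θ i (θ i))
    have hβ : 0 ≤ c.β n := sq_nonneg _
    rw [c.predVar_eq hφ]
    calc c.ε ^ 2 ≤ 4 * c.β n * c.postCov θ i (θ i) (θ i) := h2
      _ = 4 * c.β n / L * (c.postCov θ i (θ i) (θ i) * L) := by field_simp
      _ ≤ _ := by gcongr
  have hsum := Finset.sum_le_sum hterm
  rw [Finset.sum_const, Finset.card_range, nsmul_eq_mul, ← Finset.mul_sum,
    ← log_det_precision] at hsum
  have hγ := c.mutualInfo_le_γ le_rfl (fun i : Fin n => θ i)
  rw [c.mutualInfo_eq hφ] at hγ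
  have hβ : 0 ≤ c.β n := sq_nonneg _
  calc (n : ℝ) * c.ε ^ 2
      ≤ 4 * c.β n / L * Real.log (precision (c.scaledFeature φ θ) n).det := hsum
    _ ≤ 4 * c.β n / L * (2 * c.γ n) := by
        refine mul_le_mul_of_nonneg_left (by linarith) (by positivity)
    _ = c.C₁ * (c.β n * c.γ n) := by rw [C₁]; ring

lemma exists_isGreatest_evaluations
    (hsub : (fun n : ℕ => c.β n * c.γ n) =o[atTop] (fun n : ℕ => (n : ℝ))) :
    ∃ N : ℕ, IsGreatest {n : ℕ | (n : ℝ) * c.ε ^ 2 ≤ c.C₁ * (c.β n * c.γ n)} N := by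
  have hC : 0 < c.C₁ := div_pos (by norm_num) c.log_one_add_inv_sq_pos
  have hε := pow_pos c.ε_pos 2
  -- With this constant, membership of a large `n` would give `n ε² ≤ n ε² / 2`.
  have hbound := (hsub.def (show 0 < c.ε ^ 2 / (2 * c.C₁) by positivity)).and
    (eventually_gt_atTop 0)
  obtain ⟨N, hN⟩ := eventually_atTop.1 hbound
  have hbdd : BddAbove {n : ℕ | (n : ℝ) * c.ε ^ 2 ≤ c.C₁ * (c.β n * c.γ n)} := by
    refine ⟨N, fun n hn => ?_⟩
    by_contra hlt
    obtain ⟨h1, h2⟩ := hN n (by omega)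
    have hn' : (n : ℝ) * c.ε ^ 2 ≤ c.C₁ * (c.β n * c.γ n) := hn
    have h2' : (0 : ℝ) < n := by exact_mod_cast h2
    have h3 : c.β n * c.γ n ≤ c.ε ^ 2 / (2 * c.C₁) * n := by
      simpa using (le_abs_self _).trans h1
    have h4 : c.C₁ * (c.β n * c.γ n) ≤ c.C₁ * (c.ε ^ 2 / (2 * c.C₁) * n) :=
      mul_le_mul_of_nonneg_left h3 hC.le
    have h5 : c.C₁ * (c.ε ^ 2 / (2 * c.C₁) * n) = n * c.ε ^ 2 / 2 := by field_simp
    have h6 : 0 < (n : ℝ) * c.ε ^ 2 := by positivity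
    linarith
  exact ⟨_, Nat.sSup_mem ⟨0, by simp [γ_zero]⟩ hbdd, fun n hn => le_csSup hbdd hn⟩

end InformationGain

/-- The noise scaled to unit sub-Gaussian parameter. -/
lemma condSubGaussian_scaled {Ω : Type*} {mΩ : MeasurableSpace Ω} {P : Measure Ω}
    {ℱ : Filtration ℕ mΩ} {η : ℕ → Ω → ℝ} (hsG : IsCondSubGaussian P ℱ η c.σ) (n : ℕ) (s : ℝ) :
    Integrable (fun ω => Real.exp (s * (c.σ⁻¹ * η n ω))) P ∧
      P[fun ω => Real.exp (s * (c.σ⁻¹ * η n ω)) | ℱ n] ≤ᵐ[P] fun _ => Real.exp (s ^ 2 / 2) := by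
  have hσ := c.σ_pos
  have h := hsG n (s * c.σ⁻¹)
  have h1 : (s * c.σ⁻¹) ^ 2 * c.σ ^ 2 / 2 = s ^ 2 / 2 := by field_simp
  simp only [h1, mul_assoc] at h
  exact h

/-- On the complement of the large deviation event of the mixture, the confidence bounds hold. -/
lemma abs_mean_sub_le {ι : Type*} [Fintype ι] [DecidableEq ι] {φ : c.D → ι → ℝ} {w : ι → ℝ}
    (hφ : ∀ a b, φ a ⬝ᵥ φ b = c.k a b) (hw : √(w ⬝ᵥ w) ≤ c.B) (θ : ℕ → c.D) (η : ℕ → ℝ) (n : ℕ)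
    (h : mixture (c.scaledFeature φ θ) (fun i => c.σ⁻¹ * η i) n < 1 / c.δ) (x : c.D) :
    |c.mean θ (fun i => φ (θ i) ⬝ᵥ w + η i) n x - φ x ⬝ᵥ w| ≤ c.sqrtβ (n + 1) * c.sd θ n x := by
  have hδ : 0 < 1 / c.δ := one_div_pos.2 c.δ_pos
  have hobs : ∑ i ∈ Finset.range n, (c.σ⁻¹ * (φ (θ i) ⬝ᵥ w + η i)) • c.scaledFeature φ θ i =
      ∑ i ∈ Finset.range n,
        (c.scaledFeature φ θ i ⬝ᵥ w + c.σ⁻¹ * η i) • c.scaledFeature φ θ i := by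
    refine Finset.sum_congr rfl fun i _ => ?_
    simp [scaledFeature, smul_dotProduct, mul_add]
  rw [c.mean_eq hφ, hobs]
  refine (abs_posteriorMean_sub_le _ (fun i => c.σ⁻¹ * η i) n (φ x) w).trans ?_
  rw [← c.postCov_eq hφ, mul_comm]
  refine mul_le_mul_of_nonneg_right ?_ (Real.sqrt_nonneg _)
  refine add_le_add hw ?_
  have h1 := quadForm_score_le_of_mixture_lt _ _ n hδ h
  have h2 := c.mutualInfo_le_γ (Nat.le_succ n) (fun i : Fin n => θ i)
  rw [c.mutualInfo_eq hφ] at h2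
  -- The `+ 1` and the index `n + 1` of `γ` are slack; of the maximum in `sqrtβ` only `√2` is used.
  calc √_ ≤ √(2 * (c.γ (n + 1) + 1 + Real.log (1 / c.δ))) := Real.sqrt_le_sqrt (by linarith)
    _ = √2 * √(c.γ (n + 1) + 1 + Real.log (1 / c.δ)) := Real.sqrt_mul (by norm_num) _
    _ ≤ _ := mul_le_mul_of_nonneg_right (le_max_right _ _) (Real.sqrt_nonneg _)

/-! ### Pessimistic, optimistic and reachable sets -/

section Safety

lemma dst_self (x : c.D) : c.dst x x = 0 := c.d.dist_self x

variable {c}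

lemma step_mono {v v' : c.D → ℝ} {S S' : Set c.D} (hv : ∀ x, v x ≤ v' x) (hS : S ⊆ S') :
    c.step v S ⊆ c.step v' S' := fun _ ⟨x', hx', h⟩ => ⟨x', hS hx', by linarith [hv x']⟩

lemma step_iterate_mono {v v' : c.D → ℝ} {S S' : Set c.D} (hv : ∀ x, v x ≤ v' x) (hS : S ⊆ S')
    (m : ℕ) : (c.step v)^[m] S ⊆ (c.step v')^[m] S' := by
  induction m with
  | zero => exact hS
  | succ m ih =>
    rw [Function.iterate_succ_apply', Function.iterate_succ_apply']
    exact step_mono hv ih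

lemma expand_mono {v v' : c.D → ℝ} {S S' : Set c.D} (hv : ∀ x, v x ≤ v' x) (hS : S ⊆ S') :
    c.expand v S ⊆ c.expand v' S' := fun _ hx =>
  Eventually.mono hx fun m hm => step_iterate_mono hv hS m hm

lemma step_expand_subset (v : c.D → ℝ) (S : Set c.D) : c.step v (c.expand v S) ⊆ c.expand v S := by
  rintro x ⟨x', hx', h⟩
  refine (eventually_atTop.2 ?_ : ∀ᶠ m in atTop, x ∈ (c.step v)^[m] S)
  obtain ⟨N, hN⟩ := eventually_atTop.1 (show ∀ᶠ m in atTop, x' ∈ (c.step v)^[m] S from hx')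
  refine ⟨N + 1, fun m hm => ?_⟩
  obtain ⟨k, rfl⟩ : ∃ k, m = k + 1 := ⟨m - 1, by omega⟩
  rw [Function.iterate_succ_apply']
  exact ⟨x', hN k (by omega), h⟩

lemma expand_subset_of_step_subset {v : c.D → ℝ} {S S' : Set c.D} (hS : S ⊆ S')
    (h : c.step v S' ⊆ S') : c.expand v S ⊆ S' := by
  have hm : ∀ m, (c.step v)^[m] S ⊆ S' := by
    intro m
    induction m with
    | zero => exact hS
    | succ m ih =>
      rw [Function.iterate_succ_apply']
      exact (step_mono (fun _ => le_rfl) ih).trans h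
  intro x hx
  obtain ⟨m, hx⟩ := Eventually.exists (show ∀ᶠ m in atTop, x ∈ (c.step v)^[m] S from hx)
  exact hm m hx

lemma step_iterate_monotone_of_subset {v : c.D → ℝ} {S : Set c.D} (h : S ⊆ c.step v S) :
    Monotone fun m => (c.step v)^[m] S := by
  refine monotone_nat_of_le_succ fun m => ?_
  rw [Function.iterate_succ_apply]
  exact step_iterate_mono (fun _ => le_rfl) h m

lemma subset_expand {v : c.D → ℝ} {S : Set c.D} (h : S ⊆ c.step v S) : S ⊆ c.expand v S :=
  fun _ hx => Eventually.of_forall fun m => step_iterate_monotone_of_subset h (Nat.zero_le m) hx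

lemma expand_subset_step_expand {v : c.D → ℝ} {S : Set c.D} (h : S ⊆ c.step v S) :
    c.expand v S ⊆ c.step v (c.expand v S) := by
  intro x hx
  obtain ⟨N, hN⟩ := eventually_atTop.1 (show ∀ᶠ m in atTop, x ∈ (c.step v)^[m] S from hx)
  have h1 := hN (N + 1) (Nat.le_succ N)
  rw [Function.iterate_succ_apply'] at h1
  obtain ⟨x', hx', h2⟩ := h1
  exact ⟨x', eventually_atTop.2 ⟨N, fun m hm => step_iterate_monotone_of_subset h hm hx'⟩, h2⟩

variable {θ : ℕ → c.D} {y : ℕ → ℝ}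

lemma lower_mono (x : c.D) : Monotone fun n => c.lower θ y n x :=
  monotone_nat_of_le_succ fun _ => le_max_left _ _

lemma τ_le_lower {x : c.D} (hx : x ∈ c.S₀) (n : ℕ) : c.τ ≤ c.lower θ y n x := by
  refine le_trans ?_ (lower_mono x (Nat.zero_le n))
  simp [lower, lower₀, hx]

/-- A seed point is its own witness, at distance `0`; later the lower bounds only grow. Hence the
iterates defining the next pessimistic set increase, and their limit loses no point. -/
lemma pess_subset_step (n : ℕ) : c.pess θ y n ⊆ c.step (c.lower θ y (n + 1)) (c.pess θ y n) := by
  induction n with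
  | zero => exact fun x hx => ⟨x, hx, by simpa [c.dst_self] using τ_le_lower hx 1⟩
  | succ n ih =>
    exact (expand_subset_step_expand ih).trans
      (step_mono (fun x => lower_mono x (Nat.le_succ (n + 1))) le_rfl)

lemma pess_subset_succ (n : ℕ) : c.pess θ y n ⊆ c.pess θ y (n + 1) :=
  subset_expand (pess_subset_step n)

lemma seed_subset_pess (n : ℕ) : c.S₀ ⊆ c.pess θ y n := by
  induction n with
  | zero => exact le_rfl
  | succ n ih => exact ih.trans (pess_subset_succ n)

lemma reachable_subset_opti {q : c.D → ℝ} (hq : ∀ n x, q x ≤ c.upper θ y n x) (n : ℕ) :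
    c.reachable q ⊆ c.opti θ y n := by
  cases n with
  | zero => exact Set.subset_univ _
  | succ n => exact expand_mono (fun x => by linarith [hq (n + 1) x]) (seed_subset_pess n)

/-- Small widths give `u - ε < l` on the pessimistic set, so an optimistic step from it is also a
pessimistic step, under which the set is closed. -/
lemma opti_subset_pess_of_width_lt {n : ℕ}
    (h : ∀ x ∈ c.pess θ y (n + 1), c.width θ y (n + 1) x < c.ε) :
    c.opti θ y (n + 1) ⊆ c.pess θ y (n + 1) := by
  refine expand_subset_of_step_subset (pess_subset_succ n) ?_
  rintro x ⟨x', hx', h1⟩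
  refine step_expand_subset _ _ ⟨x', hx', ?_⟩
  have := h x' hx'
  simp only [width] at this
  linarith

lemma safe_of_mem_pess {q : c.D → ℝ} (hseed : ∀ s ∈ c.S₀, c.τ ≤ q s)
    (hlip : ∀ a b, |q a - q b| ≤ c.L * c.dst a b) (hq : ∀ n x, c.lower θ y n x ≤ q x) (n : ℕ) :
    c.pess θ y n ⊆ {x | c.τ ≤ q x} := by
  induction n with
  | zero => exact hseed
  | succ n ih =>
    refine expand_subset_of_step_subset ih ?_
    rintro x ⟨x', _, h⟩
    have h1 := hq (n + 1) x'
    have h2 := (abs_le.1 (hlip x x')).1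
    show c.τ ≤ q x
    linarith

lemma Evaluates.mem_pess {n : ℕ} {a x : c.D} (h : c.Evaluates θ y n a x) : x ∈ c.pess θ y n := by
  obtain ⟨_, ⟨_, h⟩ | ⟨h, _, rfl⟩⟩ := h
  exacts [h.1.1, h]

lemma Evaluates.ε_le_width {n : ℕ} {a x : c.D} (h : c.Evaluates θ y n a x) :
    c.ε ≤ c.width θ y n x := by
  obtain ⟨_, ⟨_, h⟩ | ⟨_, h, rfl⟩⟩ := h
  exacts [h.1.2, h]

lemma sd_zero (x : c.D) : c.sd θ 0 x = √(c.k x x) := by simp [sd, postCov]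

lemma width_le (n : ℕ) (x : c.D) : c.width θ y n x ≤ 2 * c.sqrtβ (n + 1) * c.sd θ n x := by
  cases n with
  | zero =>
    have h : -(c.sqrtβ 1 * √(c.k x x)) ≤ c.lower₀ x := by
      unfold lower₀
      split_ifs
      exacts [le_max_right _ _, le_rfl]
    rw [sd_zero]
    simp only [width, lower, upper, upper₀]
    linarith
  | succ n =>
    have h1 : c.upper θ y (n + 1) x ≤ _ := min_le_right _ _
    have h2 : _ ≤ c.lower θ y (n + 1) x := le_max_right _ _
    simp only [width]
    linarith

lemma not_isStuck {q : c.D → ℝ} (hq : ∀ n x, q x ≤ c.upper θ y n x)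
    (hreach : (c.reachable q).Nonempty) (hwide : ∃ s ∈ c.S₀, c.ε ≤ c.upper₀ s - c.lower₀ s)
    (n : ℕ) (a : c.D) : ¬ c.IsStuck θ y n a := by
  rintro (h | ⟨⟨ha, _⟩, hap, hw⟩)
  · obtain ⟨x, hx⟩ := hreach
    have := reachable_subset_opti hq n hx
    simp [h] at this
  · cases n with
    -- The initial optimistic set is all of `D`, not an expansion, so a wide seed point has to
    -- supply the candidate.
    | zero =>
      obtain ⟨s, hs, hε⟩ := hwide
      exact absurd (hw s hs) (not_lt.2 hε)
    | succ n => exact hap (opti_subset_pess_of_width_lt hw ha)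

lemma Terminates.sub_ε_le {q : c.D → ℝ} (hl : ∀ n x, c.lower θ y n x ≤ q x)
    (hu : ∀ n x, q x ≤ c.upper θ y n x) {n : ℕ} {a : c.D} (h : c.Terminates θ y n a) {x : c.D}
    (hx : x ∈ c.reachable q) : q x - c.ε ≤ q a := by
  obtain ⟨⟨_, hmax⟩, _, hw⟩ := h
  have h1 := hmax x (reachable_subset_opti hu n hx)
  have h2 := hl n a
  have h3 := hu n x
  simp only [width] at hw
  linarith

/-- Confidence bounds at every step carry over to the intersected bounds. -/
lemma lower_le_and_le_upper {q : c.D → ℝ} (hseed : ∀ s ∈ c.S₀, c.τ ≤ q s)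
    (h : ∀ n x, |c.mean θ y n x - q x| ≤ c.sqrtβ (n + 1) * c.sd θ n x) (n : ℕ) (x : c.D) :
    c.lower θ y n x ≤ q x ∧ q x ≤ c.upper θ y n x := by
  induction n with
  | zero =>
    have h0 := abs_le.1 (h 0 x)
    rw [sd_zero] at h0
    simp only [mean, zero_add, dotProduct_of_isEmpty, zero_sub] at h0
    simp only [lower, upper, upper₀, lower₀]
    refine ⟨?_, by linarith⟩
    split_ifs with hx
    · exact max_le (hseed x hx) (by linarith)
    · linarith
  | succ n ih =>
    have h0 := abs_le.1 (h (n + 1) x)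
    exact ⟨max_le ih.1 (by linarith), le_min ih.2 (by linarith)⟩

end Safety

end TuningProblem

lemma MPCScheme.StaysFeasible.constraintsHold {p nx nu : ℕ} {M : MPCScheme p nx nu}
    {I : Set (EuclideanSpace ℝ (Fin nx))} {a : EuclideanSpace ℝ (Fin p)}
    (h : M.StaysFeasible I a) : M.ConstraintsHold I a := by
  intro xhat u h0 hcl t
  obtain ⟨x', u', ⟨⟨hx, _, hc⟩, _⟩, hu⟩ := (hcl t).2 (h xhat u h0 hcl t)
  rw [← hx, hu]
  exact hc 0

end

/-! ### The main theorem -/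

theorem theorem1 {p nx nu : ℕ} (c : TuningProblem p)
    -- the RKHS of the kernel, and the performance function
    {H : Type*} [NormedAddCommGroup H] [InnerProductSpace ℝ H] [CompleteSpace H]
    [RKHS ℝ H c.D ℝ] (hker : ∀ a b : c.D, RKHS.kernel H a b 1 = c.k a b)
    (q : H) (hnorm : ‖q‖ ≤ c.B)
    (hlip : ∀ a b : c.D, |q a - q b| ≤ c.L * c.dst a b)
    -- the seed is safe
    (hseed : ∀ s ∈ c.S₀, c.τ ≤ q s)
    -- sublinear growth
    (hsub : (fun n : ℕ => c.β n * c.γ n) =o[atTop] (fun n : ℕ => (n : ℝ)))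
    -- MPC: performance above the threshold entails that the MPC problem stays feasible
    (M : MPCScheme p nx nu) (I : Set (EuclideanSpace ℝ (Fin nx)))
    (hmpc : ∀ a : c.D, c.τ ≤ q a → M.StaysFeasible I a)
    -- noise, evaluated parameters `θ`, goals `a` and number `T` of evaluations of a run
    {Ω : Type*} [mΩ : MeasurableSpace Ω] (P : Measure Ω) [IsProbabilityMeasure P]
    (ℱ : Filtration ℕ mΩ) (η : ℕ → Ω → ℝ) (θ a : ℕ → Ω → c.D) (T : Ω → ℕ∞)
    (hη : ∀ n, Measurable[ℱ (n + 1)] (η n)) (hsG : IsCondSubGaussian P ℱ η c.σ)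
    (hθ : ∀ n, Measurable[ℱ n] (θ n))
    (hrun : ∀ ω, c.IsRun (fun i => θ i ω) (fun i => q (θ i ω) + η i ω) (fun i => a i ω) (T ω)) :
    ∃ nstar : ℕ,
      IsGreatest {n : ℕ | (n : ℝ) * c.ε ^ 2 ≤ c.C₁ * (c.β n * c.γ n)} nstar ∧
      ∃ E : Set Ω, MeasurableSet E ∧ ENNReal.ofReal (1 - c.δ) ≤ P E ∧ ∀ ω ∈ E,
        (∀ n : ℕ, (n : ℕ∞) < T ω →
          c.τ ≤ q (θ n ω) ∧ M.ConstraintsHold I (θ n ω)) ∧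
        ((c.reachable q).Nonempty → (∃ s ∈ c.S₀, c.ε ≤ c.upper₀ s - c.lower₀ s) →
          ∃ n : ℕ, n ≤ nstar ∧ T ω = n ∧
            c.Terminates (fun i => θ i ω) (fun i => q (θ i ω) + η i ω) n (a n ω) ∧
            c.τ ≤ q (a n ω) ∧ M.ConstraintsHold I (a n ω) ∧
            ∀ x ∈ c.reachable q, q (a n ω) ≥ q x - c.ε) := by
  obtain ⟨nstar, hnstar⟩ := c.exists_isGreatest_evaluations hsub
  refine ⟨nstar, hnstar, ?_⟩
  obtain ⟨N, φ, w, hφ, hqw, hw⟩ := RKHS.exists_finite_features q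
  replace hφ : ∀ a b, φ a ⬝ᵥ φ b = c.k a b := fun a b => (hφ a b).trans (hker a b)
  obtain ⟨hmeas, hprob⟩ := LinearRegression.measure_mixture_ge_le (P := P) ℱ
    (ψ := fun n ω => c.scaledFeature φ (fun i => θ i ω) n) (ζ := fun n ω => c.σ⁻¹ * η n ω)
    (fun n => (measurable_of_finite fun x : c.D => c.σ⁻¹ • φ x).comp (hθ n))
    (fun n => (hη n).const_mul _) (c.condSubGaussian_scaled hsG) c.δ_pos
  refine ⟨_, hmeas.compl, ?_, fun ω hω => ?_⟩
  · rw [prob_compl_eq_one_sub hmeas, ENNReal.ofReal_sub _ c.δ_pos.le, ENNReal.ofReal_one]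
    exact tsub_le_tsub_left hprob 1
  have hconf : ∀ n x, |c.mean (fun i => θ i ω) (fun i => q (θ i ω) + η i ω) n x - q x| ≤
      c.sqrtβ (n + 1) * c.sd (fun i => θ i ω) n x := by
    intro n x
    have h := c.abs_mean_sub_le hφ (hw.trans hnorm) (fun i => θ i ω) (fun i => η i ω) n
      (not_le.1 fun hle => hω ⟨n, hle⟩) x
    simpa only [hqw] using h
  have hbounds := TuningProblem.lower_le_and_le_upper hseed hconf
  have hl := fun n x => (hbounds n x).1
  have hu := fun n x => (hbounds n x).2
  obtain ⟨heval, hfinal⟩ := hrun ω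
  have hsafe := TuningProblem.safe_of_mem_pess hseed hlip hl
  refine ⟨fun n hn => ?_, fun hreach hwide => ?_⟩
  · have h := hsafe n (heval n hn).mem_pess
    exact ⟨h, (hmpc _ h).constraintsHold⟩
  -- This count is deterministic: it uses the widths alone, not the confidence event. Stated for
  -- every `n ≤ T ω`, it also excludes an infinite run.
  have hcard : ∀ n : ℕ, (n : ℕ∞) ≤ T ω → n ≤ nstar := fun n hn => hnstar.2 <|
    c.card_mul_sq_le hφ (fun i => θ i ω) n fun i hi =>
      (heval i (lt_of_lt_of_le (by exact_mod_cast hi) hn)).ε_le_width.trans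
        (TuningProblem.width_le _ _)
  have htop : T ω ≠ ⊤ := fun h => absurd (hcard (nstar + 1) (h ▸ le_top)) (by omega)
  obtain ⟨n, hn⟩ := ENat.ne_top_iff_exists.1 htop
  have hterm := (hfinal n hn).resolve_right (TuningProblem.not_isStuck hu hreach hwide n _)
  have h := hsafe n hterm.2.1
  exact ⟨n, hcard n hn.le, hn.symm, hterm, h, (hmpc _ h).constraintsHold,
    fun x hx => hterm.sub_ε_le hl hu hx⟩
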